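/- Let $d\ge 2$ be an integer and let $\theta$ be a real antisymmetric $d\times d$ matrix. Let $A_\theta$ be the unital $*$-algebra generated by unitaries $U_1,\dots,U_d$ with $U_kU_l=e^{2\pi i\theta_{kl}}U_lU_k$, acting by left multiplication on the Hilbert space $L_2(\mathbb T^d_\theta)$ with orthonormal basis $U^m=U_1^{m_1}\cdots U_d^{m_d}$ ($m\in\mathbb Z^d$), and let $L_\infty(\mathbb T^d_\theta)$ be the closure of $A_\theta$ in the weak operator topology of $\mathcal B(L_2(\mathbb T^d_\theta))$, with the operator norm. For a bounded self-adjoint operator $x$ on a separable Hilbert space $\mathcal H$ and $\phi$ a function defined on $\operatorname{spec}(x)^{n+1}$, suppose that for some finite measure space $(\Omega,\nu)$ and bounded measurable $a_0,\dots,a_n:\mathbb R\times\Omega\to\mathbb C$ we have $\phi(\alpha_0,\dots,\alpha_n)=\int_\Omega a_0(\alpha_0,\omega)\cdots a_n(\alpha_n,\omega)\,d\nu(\omega)$ for all $\alpha_j\in\operatorname{spec}(x)$. The multiple operator integral $T^x_\phi:\mathcal B(\mathcal H)^n\to\mathcal B(\mathcal H)$ is then $$T^x_\phi(V_1,\dots,V_n)=\int_\Omega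 a_0(x,\omega)V_1a_1(x,\omega)\cdots V_na_n(x,\omega)\,d\nu(\omega)$$ (Borel functional calculus, weak integral). Let $g^{[n]}$ denote the $n$-th divided difference of $g$, i.e. $g^{[0]}=g$ and $g^{[n]}(\alpha_0,\dots,\alpha_n)=\frac{g^{[n-1]}(\alpha_0,\dots,\alpha_{n-1})-g^{[n-1]}(\alpha_1,\dots,\alpha_n)}{\alpha_0-\alpha_n}$ for distinct points, extended by continuity, and let $(\sigma_tg)(\alpha)=g(\alpha/t)$. **Theorem.** Let $x\in L_\infty(\mathbb T^d_\theta)$ be positive and invertible, let $f:\mathbb R\to\mathbb C$ be a Schwartz function, let $k\ge 0$ be an even integer and $n\ge 1$ an integer with $2n\ge k$, and let $F_{k,d}$ be any $\frac k2$-th order primitive of $\alpha\mapsto\alpha^{-d/2}$ on $(0,\infty)$. Then the multiple operator integrals $T^x_{(\sigma_{|s|^{-2}}f)^{[n]}}$ ($0\neq s\in\mathbb R^d$) and $T^x_{F_{k,d}^{[n]}}$ exist and are independent of the chosen representation of the symbol, and for all $b_1,\dots,b_n\in L_\infty(\mathbb T^d_\theta)$ their values at $(b_1,\dots,b_n)$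 lie in $L_\infty(\mathbb T^d_\theta)$; the function $s\mapsto |s|^{-k}\,T^x_{(\sigma_{|s|^{-2}}f)^{[n]}}(b_1,\dots,b_n)$ is Bochner integrable over $\mathbb R^d$ with values in $L_\infty(\mathbb T^d_\theta)$, the function $s\mapsto f^{(k/2)}(|s|^2)$ is integrable over $\mathbb R^d$, and $$\int_{\mathbb R^d}|s|^{-k}\,T^x_{(\sigma_{|s|^{-2}}f)^{[n]}}(b_1,\dots,b_n)\,ds=\Big(\int_{\mathbb R^d}f^{(k/2)}(|s|^2)\,ds\Big)\,T^x_{F_{k,d}^{[n]}}(b_1,\dots,b_n).$$ -/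

import Mathlib

open MeasureTheory Filter Topology Set
open scoped SchwartzMap InnerProductSpace BoundedContinuousFunction

noncomputable section

namespace NCTorus

/-! ### The noncommutative torus -/

/-- The Hilbert space `L₂(𝕋^d_θ)`, in the coordinates given by its orthonormal basis
`U^n = U_1^{n_1} ⋯ U_d^{n_d}`, `n ∈ ℤ^d`: the family `c` stands for `∑ c_n U^n`. -/
abbrev L2 (d : ℕ) : Type := lp (fun _ : Fin d → ℤ => ℂ) 2

/-- The scalar `∏_{l < k} e^{2πi θ_{kl} n_l}` picked up when `U_k` is moved past
`U_1^{n_1} ⋯ U_{k-1}^{n_{k-1}}`, so that `U_k U^n = phase θ k n • U^{n + e_k}`. -/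
def phase {d : ℕ} (θ : Matrix (Fin d) (Fin d) ℝ) (k : Fin d) (n : Fin d → ℤ) : ℂ :=
  Complex.exp ((2 * Real.pi * ∑ l ∈ Finset.univ.filter (· < k), θ k l * (n l : ℝ) : ℝ) * Complex.I)

lemma norm_phase {d : ℕ} (θ : Matrix (Fin d) (Fin d) ℝ) (k : Fin d) (n : Fin d → ℤ) :
    ‖phase θ k n‖ = 1 := Complex.norm_exp_ofReal_mul_I _

/-- The coefficients of `U_k (∑ c_n U^n) = ∑ c_n (phase θ k n) U^{n + e_k}`. -/
def genFun {d : ℕ} (θ : Matrix (Fin d) (Fin d) ℝ) (k : Fin d) (c : (Fin d → ℤ) → ℂ) :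
    (Fin d → ℤ) → ℂ :=
  fun n => phase θ k (n - Pi.single k 1) * c (n - Pi.single k 1)

lemma hasSum_genFun {d : ℕ} (θ : Matrix (Fin d) (Fin d) ℝ) (k : Fin d) (c : L2 d) :
    HasSum (fun n => ‖genFun θ k c n‖ ^ (2 : ENNReal).toReal) (‖c‖ ^ (2 : ENNReal).toReal) := by
  have h := lp.hasSum_norm (by norm_num : 0 < (2 : ENNReal).toReal) c
  have h2 := (Equiv.subRight (Pi.single k 1 : Fin d → ℤ)).hasSum_iff.mpr h
  convert h2 using 2 with n
  simp [genFun, norm_phase]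

/-- Left multiplication by the generator `U_k` on `L₂(𝕋^d_θ)`. -/
def gen {d : ℕ} (θ : Matrix (Fin d) (Fin d) ℝ) (k : Fin d) : L2 d →L[ℂ] L2 d :=
  LinearIsometry.toContinuousLinearMap
    { toFun := fun c => ⟨genFun θ k c, memℓp_gen (hasSum_genFun θ k c).summable⟩
      map_add' := fun a b => lp.ext (funext fun n => mul_add _ _ _)
      map_smul' := fun r a => lp.ext (funext fun n => mul_left_comm _ _ _)
      norm_map' := fun c => by
        have h2 : 0 < (2 : ENNReal).toReal := by norm_num
        have h := (lp.hasSum_norm h2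
          (⟨genFun θ k c, memℓp_gen (hasSum_genFun θ k c).summable⟩ : L2 d)).unique
            (hasSum_genFun θ k c)
        exact (Real.rpow_left_inj (norm_nonneg _) (norm_nonneg _) h2.ne').mp h }

/-- The unital `*`-algebra `A_θ` generated by `U_1, …, U_d`, acting on `L₂(𝕋^d_θ)` by left
multiplication. -/
def Apoly {d : ℕ} (θ : Matrix (Fin d) (Fin d) ℝ) : StarSubalgebra ℂ (L2 d →L[ℂ] L2 d) :=
  StarAlgebra.adjoin ℂ (range (gen θ))

/-- The identity map from the bounded operators with their norm topology to the bounded operators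
with the weak operator topology, as a `*`-homomorphism. -/
def toWOT (H : Type*) [NormedAddCommGroup H] [InnerProductSpace ℂ H] [CompleteSpace H] :
    (H →L[ℂ] H) →⋆ₐ[ℂ] (H →WOT[ℂ] H) where
  toFun := ContinuousLinearMapWOT.ofCLM
  map_one' := rfl
  map_mul' _ _ := rfl
  map_zero' := rfl
  map_add' _ _ := rfl
  commutes' _ := rfl
  map_star' _ := rfl

/-- The von Neumann algebra `L_∞(𝕋^d_θ)`: the closure of `A_θ` in the weak operator topology
of `B(L₂(𝕋^d_θ))`. It carries the operator norm. -/
def Linfty {d : ℕ} (θ : Matrix (Fin d) (Fin d) ℝ) : StarSubalgebra ℂ (L2 d →L[ℂ] L2 d) :=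
  (((Apoly θ).map (toWOT (L2 d))).topologicalClosure).comap (toWOT (L2 d))

instance {d : ℕ} (θ : Matrix (Fin d) (Fin d) ℝ) : CompleteSpace (Linfty θ) := by
  have h : IsClosed ((Linfty θ : StarSubalgebra ℂ (L2 d →L[ℂ] L2 d)) :
      Set (L2 d →L[ℂ] L2 d)) :=
    (StarSubalgebra.isClosed_topologicalClosure _).preimage
      ContinuousLinearMapWOT.continuous_ofCLM
  exact h.completeSpace_coe

end NCTorus

namespace MOI

/-! ### Multiple operator integrals -/

variable {H : Type*} [NormedAddCommGroup H] [InnerProductSpace ℂ H] [CompleteSpace H]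

/-- `μ` is the spectral measure of the bounded self-adjoint operator `x` at the vector `ξ`, that is,
`∫ g dμ = ⟨ξ, g(x) ξ⟩` for all bounded continuous `g`, with `g(x)` given by the continuous
functional calculus. -/
def IsSpectralMeasure (x : H →L[ℂ] H) (ξ : H) (μ : Measure ℝ) : Prop :=
  IsFiniteMeasure μ ∧ ∀ g : ℝ →ᵇ ℝ, ⟪ξ, cfc (fun t => g t) x ξ⟫_ℂ = ((∫ t, g t ∂μ : ℝ) : ℂ)

/-- `A = g(x)` in the sense of the bounded Borel functional calculus: the quadratic form of `A` is
`ξ ↦ ∫ g dμ_ξ`, where `μ_ξ` is the spectral measure of `x` at `ξ`. -/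
def IsBorelCalculus (x : H →L[ℂ] H) (g : ℝ → ℂ) (A : H →L[ℂ] H) : Prop :=
  ∀ ξ : H, ∃ μ : Measure ℝ, IsSpectralMeasure x ξ μ ∧ ⟪ξ, A ξ⟫_ℂ = ∫ t, g t ∂μ

/-- The alternating product `A_0 V_1 A_1 V_2 ⋯ V_n A_n`. -/
def altProd {n : ℕ} (A : Fin (n + 1) → H →L[ℂ] H) (V : Fin n → H →L[ℂ] H) : H →L[ℂ] H :=
  A 0 * (List.ofFn fun j : Fin n => V j * A j.succ).prod

/-- `T` is a multiple operator integral with symbol `φ`: for a finite measure space `(Ω, ν)` and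
bounded measurable functions `a_0, …, a_n : ℝ × Ω → ℂ` one has
`φ(α_0, …, α_n) = ∫ a_0(α_0, ω) ⋯ a_n(α_n, ω) dν(ω)` for all `α_j` in the spectrum of `x`, and
`T(V_1, …, V_n) = ∫ a_0(x, ω) V_1 a_1(x, ω) ⋯ V_n a_n(x, ω) dν(ω)`, the latter integral being
taken in the weak sense. -/
def IsMultOpInt (x : H →L[ℂ] H) {n : ℕ} (φ : (Fin (n + 1) → ℝ) → ℂ)
    (T : (Fin n → H →L[ℂ] H) → H →L[ℂ] H) : Prop :=
  ∃ (Ω : Type) (_ : MeasurableSpace Ω) (ν : Measure Ω) (a : Fin (n + 1) → ℝ × Ω → ℂ)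
    (A : Fin (n + 1) → Ω → H →L[ℂ] H),
    IsFiniteMeasure ν ∧
    (∀ j, Measurable (a j)) ∧
    (∃ C : ℝ, ∀ j p, ‖a j p‖ ≤ C) ∧
    (∀ α : Fin (n + 1) → ℝ, (∀ j, α j ∈ spectrum ℝ x) →
      φ α = ∫ ω, ∏ j, a j (α j, ω) ∂ν) ∧
    (∀ j ω, IsBorelCalculus x (fun t => a j (t, ω)) (A j ω)) ∧
    ∀ V ξ η, ⟪η, T V ξ⟫_ℂ = ∫ ω, ⟪η, altProd (fun j => A j ω) V ξ⟫_ℂ ∂ν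

open Classical in
/-- The multiple operator integral `T^x_φ(V_1, …, V_n)` (zero if `φ` is not the symbol of one). -/
def multOpInt (x : H →L[ℂ] H) {n : ℕ} (φ : (Fin (n + 1) → ℝ) → ℂ)
    (V : Fin n → H →L[ℂ] H) : H →L[ℂ] H :=
  if h : ∃ T, IsMultOpInt x φ T then h.choose V else 0

/-- Divided differences at pairwise distinct points:
`f^{[n]}(α_0, …, α_n) = (f^{[n-1]}(α_0, …, α_{n-1}) - f^{[n-1]}(α_1, …, α_n)) / (α_0 - α_n)`. -/
def divDiffAux (f : ℝ → ℂ) : (n : ℕ) → (Fin (n + 1) → ℝ) → ℂ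
  | 0, α => f (α 0)
  | n + 1, α =>
    (divDiffAux f n (fun j => α j.castSucc) - divDiffAux f n (fun j => α j.succ)) /
      ((α 0 - α (Fin.last (n + 1)) : ℝ) : ℂ)

/-- The divided difference `f^{[n]}`, extended by continuity from the tuples of pairwise distinct
points to all tuples. -/
def divDiff (f : ℝ → ℂ) (n : ℕ) : (Fin (n + 1) → ℝ) → ℂ :=
  extendFrom {α | Function.Injective α} (divDiffAux f n)

/-- The dilation `(σ_t f)(α) = f(α / t)`. -/
def dilation (t : ℝ) (f : ℝ → ℂ) : ℝ → ℂ := fun α => f (α / t)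

/-- `IsPrimitiveOn S g m F`: on `S`, the function `F` is an `m`-th order primitive of `g`. -/
def IsPrimitiveOn (S : Set ℝ) (g : ℝ → ℂ) : ℕ → (ℝ → ℂ) → Prop
  | 0, F => EqOn F g S
  | m + 1, F => ∃ G, IsPrimitiveOn S g m G ∧ ∀ α ∈ S, HasDerivAt F (G α) α

end MOI

end

open NCTorus MOI

open NCTorus MOI

set_option linter.unusedSectionVars false

namespace MOI

variable {H : Type*} [NormedAddCommGroup H] [InnerProductSpace ℂ H] [CompleteSpace H]

/-! ### Spectral measures -/

/-! A multiple operator integral is determined by its symbol on the spectrum of `x`, so the identity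
of operators reduces to an identity of symbols.

Determinacy (`IsMultOpInt.unique`): inserting an orthonormal basis next to each `V_j` expands a
matrix coefficient of `A_0 V_1 A_1 ⋯ V_n A_n` into products of matrix coefficients of the `A_j`. By
polarization and Fubini, the integral over `Ω` of such a product is a combination of integrals of
`φ` against products of spectral measures of `x` (`integral_prod_inner_eq`), in which the
representation no longer appears.

Identity of symbols: write `k = 2j`, `n = p + j`, `h = f^{(j)}`. The Hermite–Genocchi formula
`IsSimplex.divDiff_eq` gives `g^{[n]}(α)` as the average of `g^{(n)}(∑ λ_i α_i)` over the simplex.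
For the dilated function, multiplied by `|s|^{-k}`, this is the average of `|s|^{2p} h^{(p)}(|s|²
u)` with `u = ∑ λ_i α_i`. Polar coordinates, repeated integration by parts and scaling
(`integral_norm_pow_mul_iterDeriv`) turn its integral over `s` into `∏_{i<p} (-d/2 - i) · u^{-d/2-p}
· ∫ h(|s|²) ds`. The factor in front of `∫ h(|s|²) ds` is `F^{(n)}(u)`, since `F^{(j)}(u) =
u^{-d/2}`; averaging gives `F^{[n]}(α)`.

It remains to see that the integral over `s` of the operator integrals is again a multiple operator
integral (`IsSimplex.isMultOpInt_integral`). For this, `exists_dilation_rep` writes `u ↦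
h^{(p)}(cu)` on an interval around the spectrum as a superposition of exponentials with coefficients
of order `(1 + c)^{-N}`; at `c = |s|²` these pay for `|s|^{2p}` and for integrability over `ℝ^d`.
Everything becomes a norm-convergent integral of products of `e^{iyx}` and `b_i`, which also places
the values in `L_∞`. -/

lemma inner_eq_re_of_isSelfAdjoint {A : H →L[ℂ] H} (hA : IsSelfAdjoint A) (ξ : H) :
    ⟪ξ, A ξ⟫_ℂ = (((⟪ξ, A ξ⟫_ℂ).re : ℝ) : ℂ) := by
  rw [eq_comm, ← Complex.conj_eq_iff_re, inner_conj_symm]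
  exact (ContinuousLinearMap.isSelfAdjoint_iff_isSymmetric.mp hA) ξ ξ

/-- The positive linear functional `g ↦ ⟨ξ, g(x) ξ⟩` on the continuous functions on the
spectrum. -/
noncomputable def vectorState (x : H →L[ℂ] H) (hx : IsSelfAdjoint x) (ξ : H) :
    CompactlySupportedContinuousMap (spectrum ℝ x) ℝ →ₚ[ℝ] ℝ where
  toFun g := (⟪ξ, cfcHom hx (g : C(spectrum ℝ x, ℝ)) ξ⟫_ℂ).re
  map_add' f g := by
    have : ((f + g : CompactlySupportedContinuousMap (spectrum ℝ x) ℝ) : C(spectrum ℝ x, ℝ))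
      = (f : C(spectrum ℝ x, ℝ)) + g := rfl
    rw [this, map_add]; simp
  map_smul' r g := by
    have : ((r • g : CompactlySupportedContinuousMap (spectrum ℝ x) ℝ) : C(spectrum ℝ x, ℝ))
      = r • (g : C(spectrum ℝ x, ℝ)) := rfl
    rw [this, map_smul]
    simp [← Complex.coe_smul]
  monotone' f g hfg := by
    have h : (cfcHom hx (f : C(spectrum ℝ x, ℝ))) ≤ cfcHom hx (g : C(spectrum ℝ x, ℝ)) := by
      rw [← sub_nonneg, ← map_sub, cfcHom_nonneg_iff hx]
      intro t
      exact sub_nonneg.mpr (hfg t)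
    have h2 := (ContinuousLinearMap.le_def _ _).mp h
    have h3 := h2.re_inner_nonneg_right ξ
    simp only [sub_apply, inner_sub_right, map_sub] at h3
    simpa using! h3

/-- Riesz–Markov–Kakutani on the compact spectrum, pushed forward to the line. The concentration on
the spectrum matters because symbols are represented only there. -/
lemma exists_isSpectralMeasure {x : H →L[ℂ] H} (hx : IsSelfAdjoint x) (ξ : H) :
    ∃ μ : Measure ℝ, IsSpectralMeasure x ξ μ ∧ ∀ᵐ t ∂μ, t ∈ spectrum ℝ x := by
  have : CompactSpace (spectrum ℝ x) := isCompact_iff_compactSpace.mp (spectrum.isCompact x)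
  let Λ := vectorState x hx ξ
  have hms : MeasurableSet (spectrum ℝ x) := (spectrum.isClosed x).measurableSet
  have hfin : IsFiniteMeasure (RealRMK.rieszMeasure Λ) := by
    refine ⟨?_⟩
    -- On a compact space the constant 1 has compact support, so it bounds the total mass.
    have h := RealRMK.rieszMeasure_le_of_eq_one Λ
      (f := CompactlySupportedContinuousMap.continuousMapEquiv (1 : C(spectrum ℝ x, ℝ)))
      (fun _ => zero_le_one) isCompact_univ (fun _ _ => rfl)
    exact h.trans_lt ENNReal.ofReal_lt_top
  refine ⟨(RealRMK.rieszMeasure Λ).map Subtype.val, ⟨inferInstance, fun g => ?_⟩, ?_⟩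
  · rw [integral_map measurable_subtype_coe.aemeasurable
      g.continuous.aestronglyMeasurable]
    let g' : CompactlySupportedContinuousMap (spectrum ℝ x) ℝ :=
      CompactlySupportedContinuousMap.continuousMapEquiv
        ⟨fun t => g t.1, g.continuous.comp continuous_subtype_val⟩
    have h := RealRMK.integral_rieszMeasure Λ g'
    change ∫ t : spectrum ℝ x, g t ∂(RealRMK.rieszMeasure Λ) = Λ g' at h
    rw [h, inner_eq_re_of_isSelfAdjoint (cfc_predicate _ x)]
    rw [cfc_apply (fun t => g t) x hx g.continuous.continuousOn]
    rfl
  · refine (ae_map_iff (p := fun t => t ∈ spectrum ℝ x)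
      measurable_subtype_coe.aemeasurable hms).mpr ?_
    exact Eventually.of_forall fun t => t.2

lemma IsSpectralMeasure.unique {x : H →L[ℂ] H} {ξ : H} {μ ν : Measure ℝ}
    (hμ : IsSpectralMeasure x ξ μ) (hν : IsSpectralMeasure x ξ ν) : μ = ν := by
  have := hμ.1
  have := hν.1
  refine ext_of_forall_integral_eq_of_IsFiniteMeasure fun g => ?_
  have h := (hμ.2 g).symm.trans (hν.2 g)
  exact_mod_cast h

/-- The spectral measure of a self-adjoint operator at a vector. -/
noncomputable def spectralMeasure {x : H →L[ℂ] H} (hx : IsSelfAdjoint x) (ξ : H) : Measure ℝ :=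
  (exists_isSpectralMeasure hx ξ).choose

lemma isSpectralMeasure_spectralMeasure {x : H →L[ℂ] H} (hx : IsSelfAdjoint x) (ξ : H) :
    IsSpectralMeasure x ξ (spectralMeasure hx ξ) := (exists_isSpectralMeasure hx ξ).choose_spec.1

instance {x : H →L[ℂ] H} (hx : IsSelfAdjoint x) (ξ : H) :
    IsFiniteMeasure (spectralMeasure hx ξ) := (isSpectralMeasure_spectralMeasure hx ξ).1

lemma ae_mem_spectrum {x : H →L[ℂ] H} (hx : IsSelfAdjoint x) (ξ : H) :
    ∀ᵐ t ∂(spectralMeasure hx ξ), t ∈ spectrum ℝ x :=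
  (exists_isSpectralMeasure hx ξ).choose_spec.2

lemma spectralMeasure_real_univ {x : H →L[ℂ] H} (hx : IsSelfAdjoint x) (ξ : H) :
    (spectralMeasure hx ξ).real univ = ‖ξ‖ ^ 2 := by
  have h := (isSpectralMeasure_spectralMeasure hx ξ).2 (BoundedContinuousFunction.const ℝ 1)
  have h1 : cfc (fun _ : ℝ => (1 : ℝ)) x = 1 := cfc_const_one ℝ x
  simp only [BoundedContinuousFunction.const_apply, h1, one_apply_eq_self,
    integral_const, smul_eq_mul, mul_one, inner_self_eq_norm_sq_to_K] at h
  exact Complex.ofReal_injective (by simpa using h.symm)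

/-- Uniqueness of spectral measures replaces the measure hidden in the existential by one fixed
choice for each vector. -/
lemma IsBorelCalculus.inner_eq {x A : H →L[ℂ] H} (hx : IsSelfAdjoint x) {g : ℝ → ℂ}
    (h : IsBorelCalculus x g A) (ξ : H) :
    ⟪ξ, A ξ⟫_ℂ = ∫ t, g t ∂(spectralMeasure hx ξ) := by
  obtain ⟨μ, hμ, h⟩ := h ξ
  rw [h, hμ.unique (isSpectralMeasure_spectralMeasure hx ξ)]

/-- The sign `1, -1, i, -i` of the four terms of the polarization identity. -/
noncomputable def polarSign : Fin 4 → ℂ := ![1, -1, Complex.I, -Complex.I]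

lemma norm_polarSign (k : Fin 4) : ‖polarSign k‖ = 1 := by
  fin_cases k <;> simp [polarSign]

lemma inner_eq_sum_polar (A : H →L[ℂ] H) (u v : H) :
    ⟪u, A v⟫_ℂ = ∑ k, (4 : ℂ)⁻¹ * starRingEnd ℂ (polarSign k) *
      ⟪u + polarSign k • v, A (u + polarSign k • v)⟫_ℂ := by
  simp only [Fin.sum_univ_four, polarSign, Matrix.cons_val_zero, Matrix.cons_val_one,
    Matrix.cons_val, map_add, map_smul, inner_add_left, inner_add_right, inner_smul_left,
    inner_smul_right, map_neg, map_one, Complex.conj_I]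
  ring_nf
  simp only [Complex.I_sq]
  ring

/-- Weak measurability and boundedness of a family of operators. -/
def IsWeakBdd {Ω : Type*} [MeasurableSpace Ω] (ν : Measure Ω) (A : Ω → H →L[ℂ] H) : Prop :=
  (∀ u v, AEStronglyMeasurable (fun ω => ⟪u, A ω v⟫_ℂ) ν) ∧ ∃ C, ∀ ω, ‖A ω‖ ≤ C

/-- Polarization of the bound `C‖w‖²` on the quadratic form. The factor 4 is four terms of weight
`1/4` at vectors of norm at most `2‖v‖`; the sharp constant is not needed. -/
lemma IsBorelCalculus.norm_le {x A : H →L[ℂ] H} (hx : IsSelfAdjoint x) {g : ℝ → ℂ}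
    (h : IsBorelCalculus x g A) {C : ℝ} (hC : ∀ t, ‖g t‖ ≤ C) : ‖A‖ ≤ 4 * C := by
  have hC0 : 0 ≤ C := (norm_nonneg _).trans (hC 0)
  have hq (w : H) : ‖⟪w, A w⟫_ℂ‖ ≤ C * ‖w‖ ^ 2 := by
    rw [h.inner_eq hx, ← spectralMeasure_real_univ hx]
    exact norm_integral_le_of_norm_le_const (Eventually.of_forall hC)
  refine ContinuousLinearMap.opNorm_le_bound _ (by positivity) fun v => ?_
  by_cases hv : A v = 0
  · rw [hv, norm_zero]; positivity
  have hv0 : v ≠ 0 := fun h => hv (by rw [h, map_zero])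
  have h1 : 0 < ‖v‖ := norm_pos_iff.mpr hv0
  have h2 : 0 < ‖A v‖ := norm_pos_iff.mpr hv
  -- The multiple of `A v` with the norm of `v`: it attains `‖v‖ ‖A v‖` and keeps the polarization
  -- vectors within `2‖v‖`.
  set u : H := (((‖v‖ / ‖A v‖ : ℝ)) : ℂ) • A v with hu
  have hun : ‖u‖ = ‖v‖ := by
    rw [hu, norm_smul, Complex.norm_real, Real.norm_of_nonneg (by positivity)]
    field_simp
  have h3 : ‖⟪u, A v⟫_ℂ‖ = ‖v‖ * ‖A v‖ := by
    rw [hu, inner_smul_left, norm_mul, inner_self_eq_norm_sq_to_K]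
    simp only [Complex.conj_ofReal, Complex.norm_real, norm_pow, Complex.coe_algebraMap,
      norm_div, norm_norm]
    field_simp
  have h4 : ‖⟪u, A v⟫_ℂ‖ ≤ ∑ _k : Fin 4, C * ‖v‖ ^ 2 := by
    rw [inner_eq_sum_polar]
    refine (norm_sum_le _ _).trans (Finset.sum_le_sum fun k _ => ?_)
    rw [norm_mul, norm_mul, RCLike.norm_conj, norm_polarSign]
    have h5 : ‖u + polarSign k • v‖ ≤ 2 * ‖v‖ := by
      refine (norm_add_le _ _).trans ?_
      rw [hun, norm_smul, norm_polarSign]; linarith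
    have h6 := (hq (u + polarSign k • v)).trans
      (mul_le_mul_of_nonneg_left (pow_le_pow_left₀ (norm_nonneg _) h5 2) hC0)
    rw [show ‖(4 : ℂ)⁻¹‖ = 4⁻¹ by norm_num]
    linarith
  rw [h3] at h4
  simp only [Finset.sum_const, Finset.card_univ, Fintype.card_fin, nsmul_eq_mul] at h4
  push_cast at h4
  nlinarith

/-- Polarization writes matrix coefficients as integrals of `a (·, ω)` against spectral measures
that do not depend on `ω`, hence measurable in `ω`. -/
lemma isWeakBdd_of_isBorelCalculus {Ω : Type*} [MeasurableSpace Ω] {ν : Measure Ω}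
    {x : H →L[ℂ] H} (hx : IsSelfAdjoint x) {a : ℝ × Ω → ℂ} (ha : Measurable a) {C : ℝ}
    (hC : ∀ p, ‖a p‖ ≤ C) {A : Ω → H →L[ℂ] H}
    (hA : ∀ ω, IsBorelCalculus x (fun t => a (t, ω)) (A ω)) : IsWeakBdd ν A := by
  refine ⟨fun u v => ?_, 4 * C, fun ω => (hA ω).norm_le hx fun t => hC _⟩
  have h : (fun ω => ⟪u, A ω v⟫_ℂ) = fun ω => ∑ k, (4 : ℂ)⁻¹ * starRingEnd ℂ (polarSign k) *
      ∫ t, a (t, ω) ∂(spectralMeasure hx (u + polarSign k • v)) :=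
    funext fun ω => by simp only [inner_eq_sum_polar (A ω) u v, (hA ω).inner_eq hx]
  rw [h]
  refine (Measurable.stronglyMeasurable ?_).aestronglyMeasurable
  refine Finset.measurable_sum _ fun k _ => Measurable.const_mul ?_ _
  exact (StronglyMeasurable.integral_prod_left' (f := a) ha.stronglyMeasurable).measurable

lemma isWeakBdd_const {Ω : Type*} [MeasurableSpace Ω] {ν : Measure Ω} (V : H →L[ℂ] H) :
    IsWeakBdd ν (fun _ => V) :=
  ⟨fun _ _ => aestronglyMeasurable_const, ‖V‖, fun _ => le_rfl⟩

/-! ### Products of weakly measurable families -/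

lemma norm_sum_inner_mul_inner_le {ι : Type*} (e : HilbertBasis ι ℂ H) (s : Finset ι) (u v : H) :
    ‖∑ i ∈ s, ⟪u, e i⟫_ℂ * ⟪e i, v⟫_ℂ‖ ≤ ‖u‖ * ‖v‖ := by
  refine (norm_sum_le _ _).trans ?_
  simp_rw [norm_mul, norm_inner_symm u]
  refine (Real.sum_mul_le_sqrt_mul_sqrt _ _ _).trans ?_
  gcongr
  · rw [Real.sqrt_le_left (norm_nonneg _)]
    exact e.orthonormal.sum_inner_products_le u
  · rw [Real.sqrt_le_left (norm_nonneg _)]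
    exact e.orthonormal.sum_inner_products_le v

lemma hasSum_inner_mul {ι : Type*} (e : HilbertBasis ι ℂ H) (A B : H →L[ℂ] H) (u v : H) :
    HasSum (fun i => ⟪u, A (e i)⟫_ℂ * ⟪e i, B v⟫_ℂ) ⟪u, (A * B) v⟫_ℂ := by
  have h := e.hasSum_inner_mul_inner (A.adjoint u) (B v)
  simp only [ContinuousLinearMap.adjoint_inner_left] at h
  exact h

lemma norm_sum_inner_mul_le {ι : Type*} (e : HilbertBasis ι ℂ H) (A B : H →L[ℂ] H) (u v : H)
    (s : Finset ι) :
    ‖∑ i ∈ s, ⟪u, A (e i)⟫_ℂ * ⟪e i, B v⟫_ℂ‖ ≤ ‖A‖ * ‖u‖ * (‖B‖ * ‖v‖) := by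
  have h := norm_sum_inner_mul_inner_le e s (A.adjoint u) (B v)
  simp only [ContinuousLinearMap.adjoint_inner_left] at h
  refine h.trans ?_
  gcongr
  · exact (ContinuousLinearMap.le_opNorm _ _).trans_eq (by rw [LinearIsometryEquiv.norm_map])
  · exact ContinuousLinearMap.le_opNorm _ _

/-- Parseval exhibits a coefficient of the product as a limit of finite sums of products of
coefficients. Countability of the basis lets measurability pass to this limit. -/
lemma IsWeakBdd.mul {ι : Type*} [Countable ι] (e : HilbertBasis ι ℂ H) {Ω : Type*}
    [MeasurableSpace Ω] {ν : Measure Ω} {A B : Ω → H →L[ℂ] H} (hA : IsWeakBdd ν A)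
    (hB : IsWeakBdd ν B) : IsWeakBdd ν (fun ω => A ω * B ω) := by
  obtain ⟨hA, C, hC⟩ := hA
  obtain ⟨hB, D, hD⟩ := hB
  refine ⟨fun u v => ?_, C * D, fun ω => (norm_mul_le _ _).trans ?_⟩
  · refine aestronglyMeasurable_of_tendsto_ae (atTop : Filter (Finset ι))
      (f := fun s ω => ∑ i ∈ s, ⟪u, A ω (e i)⟫_ℂ * ⟪e i, B ω v⟫_ℂ) (fun s => ?_)
      (Eventually.of_forall fun ω => hasSum_inner_mul e (A ω) (B ω) u v)
    exact Finset.aestronglyMeasurable_fun_sum _ fun i _ => (hA _ _).mul (hB _ _)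
  · have := (norm_nonneg _).trans (hC ω)
    gcongr
    · exact hC ω
    · exact hD ω

lemma altProd_succ {n : ℕ} (A : Fin (n + 2) → H →L[ℂ] H) (V : Fin (n + 1) → H →L[ℂ] H) :
    altProd A V = A 0 * (V 0 * altProd (fun j => A j.succ) (fun j => V j.succ)) := by
  simp only [altProd, List.ofFn_succ, List.prod_cons, mul_assoc]

lemma altProd_zero (A : Fin 1 → H →L[ℂ] H) (V : Fin 0 → H →L[ℂ] H) : altProd A V = A 0 := by
  simp [altProd]

lemma IsWeakBdd.altProd {ι : Type*} [Countable ι] (e : HilbertBasis ι ℂ H) {Ω : Type*}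
    [MeasurableSpace Ω] {ν : Measure Ω} {n : ℕ} {A : Fin (n + 1) → Ω → H →L[ℂ] H}
    (hA : ∀ j, IsWeakBdd ν (A j)) (V : Fin n → H →L[ℂ] H) :
    IsWeakBdd ν (fun ω => altProd (fun j => A j ω) V) := by
  induction n with
  | zero => simpa only [altProd_zero] using hA 0
  | succ n ih =>
    simp only [altProd_succ]
    exact (hA 0).mul e ((isWeakBdd_const _).mul e (ih (fun j => hA j.succ) _))

end MOI

namespace MOI

variable {H : Type*} [NormedAddCommGroup H] [InnerProductSpace ℂ H] [CompleteSpace H]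

/-! ### Independence of the representation -/

/-- Inserting the basis after `A_0` splits off one factor; Bessel and Cauchy–Schwarz bound all
partial sums uniformly, so dominated convergence applies. The weight `ρ` is there to collect the
factors already split off in the induction of `integral_altProd_congr`. -/
lemma tendsto_sum_integral_altProd {ι : Type*} [Countable ι] (e : HilbertBasis ι ℂ H)
    {Ω : Type*} [MeasurableSpace Ω] {ν : Measure Ω} [IsFiniteMeasure ν] {n : ℕ}
    {A : Fin (n + 2) → Ω → H →L[ℂ] H} (hA : ∀ j, IsWeakBdd ν (A j)) {ρ : Ω → ℂ}
    (hρ : AEStronglyMeasurable ρ ν) {C : ℝ} (hC : ∀ ω, ‖ρ ω‖ ≤ C)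
    (V : Fin (n + 1) → H →L[ℂ] H) (η ξ : H) :
    Tendsto (fun s : Finset ι => ∑ i ∈ s, ∫ ω, (ρ ω * ⟪η, A 0 ω (e i)⟫_ℂ) *
      ⟪(V 0).adjoint (e i), altProd (fun j => A j.succ ω) (fun j => V j.succ) ξ⟫_ℂ ∂ν) atTop
      (𝓝 (∫ ω, ρ ω * ⟪η, altProd (fun j => A j ω) V ξ⟫_ℂ ∂ν)) := by
  have hB := (isWeakBdd_const (ν := ν) (V 0)).mul e
    (IsWeakBdd.altProd e (fun j => hA j.succ) (fun j => V j.succ))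
  obtain ⟨D, hD⟩ := (hA 0).2
  obtain ⟨E, hE⟩ := hB.2
  have hbd : ∀ (s : Finset ι) (ω : Ω), ‖∑ i ∈ s, (ρ ω * ⟪η, A 0 ω (e i)⟫_ℂ) *
      ⟪(V 0).adjoint (e i), altProd (fun j => A j.succ ω) (fun j => V j.succ) ξ⟫_ℂ‖ ≤
      C * (D * ‖η‖ * (E * ‖ξ‖)) := by
    intro s ω
    simp_rw [ContinuousLinearMap.adjoint_inner_left, mul_assoc, ← Finset.mul_sum, norm_mul]
    have h0 := (norm_nonneg _).trans (hC ω)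
    refine mul_le_mul (hC ω) ?_ (norm_nonneg _) h0
    · refine (norm_sum_inner_mul_le e (A 0 ω)
        (V 0 * altProd (fun j => A j.succ ω) (fun j => V j.succ)) η ξ s).trans ?_
      rw [← mul_assoc D]
      have h1 := hD ω
      have h2 := hE ω
      exact mul_le_mul (mul_le_mul_of_nonneg_right h1 (norm_nonneg η))
        (mul_le_mul_of_nonneg_right h2 (norm_nonneg _)) (by positivity)
        (mul_nonneg ((norm_nonneg _).trans h1) (norm_nonneg η))
  have hm : ∀ i, AEStronglyMeasurable (fun ω => (ρ ω * ⟪η, A 0 ω (e i)⟫_ℂ) *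
      ⟪(V 0).adjoint (e i), altProd (fun j => A j.succ ω) (fun j => V j.succ) ξ⟫_ℂ) ν :=
    fun i => (hρ.mul ((hA 0).1 _ _)).mul
      ((IsWeakBdd.altProd e (fun j => hA j.succ) (fun j => V j.succ)).1 _ _)
  have hi : ∀ i, Integrable (fun ω => (ρ ω * ⟪η, A 0 ω (e i)⟫_ℂ) *
      ⟪(V 0).adjoint (e i), altProd (fun j => A j.succ ω) (fun j => V j.succ) ξ⟫_ℂ) ν :=
    fun i => Integrable.of_bound (hm i) _ (Eventually.of_forall fun ω => by
      simpa using hbd {i} ω)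
  simp_rw [← integral_finsetSum _ fun i _ => hi i]
  refine tendsto_integral_filter_of_dominated_convergence (fun _ => _)
    (Eventually.of_forall fun s => Finset.aestronglyMeasurable_fun_sum _ fun i _ => hm i)
    (Eventually.of_forall fun s => Eventually.of_forall (hbd s)) (integrable_const _)
    (Eventually.of_forall fun ω => ?_)
  simp_rw [ContinuousLinearMap.adjoint_inner_left, mul_assoc, altProd_succ, ← Finset.mul_sum]
  simpa only [mul_assoc, Finset.mul_sum] using! (hasSum_inner_mul e (A 0 ω)
      (V 0 * altProd (fun j => A j.succ ω) (fun j => V j.succ)) η ξ).mul_left (ρ ω)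

/-- Each quadratic form is an integral against a spectral measure; after Fubini the inner integral
over `Ω` is `φ`, almost everywhere because the spectral measures live on the spectrum. -/
lemma integral_prod_inner_self_eq {Ω : Type*} [MeasurableSpace Ω] {ν : Measure Ω}
    [IsFiniteMeasure ν] {x : H →L[ℂ] H} (hx : IsSelfAdjoint x) {n : ℕ}
    {a : Fin (n + 1) → ℝ × Ω → ℂ} (ha : ∀ j, Measurable (a j)) {C : ℝ}
    (hC : ∀ j p, ‖a j p‖ ≤ C) {A : Fin (n + 1) → Ω → H →L[ℂ] H}
    (hA : ∀ j ω, IsBorelCalculus x (fun t => a j (t, ω)) (A j ω))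
    {φ : (Fin (n + 1) → ℝ) → ℂ} (hφ : ∀ α : Fin (n + 1) → ℝ, (∀ j, α j ∈ spectrum ℝ x) →
      φ α = ∫ ω, ∏ j, a j (α j, ω) ∂ν) (w : Fin (n + 1) → H) :
    ∫ ω, ∏ j, ⟪w j, A j ω (w j)⟫_ℂ ∂ν =
      ∫ α, φ α ∂(Measure.pi fun j => spectralMeasure hx (w j)) := by
  have h1 : ∀ ω, ∏ j, ⟪w j, A j ω (w j)⟫_ℂ =
      ∫ α : Fin (n + 1) → ℝ, ∏ j, a j (α j, ω) ∂(Measure.pi fun j => spectralMeasure hx (w j)) := by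
    intro ω
    rw [integral_fintype_prod_eq_prod (fun j t => a j (t, ω))]
    exact Finset.prod_congr rfl fun j _ => (hA j ω).inner_eq hx _
  simp_rw [h1]
  rw [integral_integral_swap]
  · refine integral_congr_ae ?_
    have h2 : ∀ᵐ α ∂(Measure.pi fun j => spectralMeasure hx (w j)), ∀ j, α j ∈ spectrum ℝ x :=
      ae_all_iff.mpr fun j => Measure.tendsto_eval_ae_ae.eventually (ae_mem_spectrum hx (w j))
    filter_upwards [h2] with α hα
    exact (hφ α hα).symm
  · refine Integrable.of_bound (C := C ^ (n + 1)) ?_ (Eventually.of_forall fun p => ?_)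
    · refine (Finset.measurable_fun_prod _ fun j _ => (ha j).comp ?_).aestronglyMeasurable
      fun_prop
    · simp only [Function.uncurry, norm_prod]
      refine (Finset.prod_le_prod (fun _ _ => norm_nonneg _) fun j _ => hC j _).trans_eq ?_
      simp

/-- Polarization in every slot. The right-hand side no longer involves `Ω`, `a` or `A`, which is the
source of independence of the representation. -/
lemma integral_prod_inner_eq {Ω : Type*} [MeasurableSpace Ω] {ν : Measure Ω}
    [IsFiniteMeasure ν] {x : H →L[ℂ] H} (hx : IsSelfAdjoint x) {n : ℕ}
    {a : Fin (n + 1) → ℝ × Ω → ℂ} (ha : ∀ j, Measurable (a j)) {C : ℝ}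
    (hC : ∀ j p, ‖a j p‖ ≤ C) {A : Fin (n + 1) → Ω → H →L[ℂ] H}
    (hA : ∀ j ω, IsBorelCalculus x (fun t => a j (t, ω)) (A j ω))
    {φ : (Fin (n + 1) → ℝ) → ℂ} (hφ : ∀ α : Fin (n + 1) → ℝ, (∀ j, α j ∈ spectrum ℝ x) →
      φ α = ∫ ω, ∏ j, a j (α j, ω) ∂ν) (u v : Fin (n + 1) → H) :
    ∫ ω, ∏ j, ⟪u j, A j ω (v j)⟫_ℂ ∂ν =
      ∑ κ : Fin (n + 1) → Fin 4, (∏ j, (4 : ℂ)⁻¹ * starRingEnd ℂ (polarSign (κ j))) *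
        ∫ α, φ α ∂(Measure.pi fun j => spectralMeasure hx (u j + polarSign (κ j) • v j)) := by
  have h : ∀ ω, ∏ j, ⟪u j, A j ω (v j)⟫_ℂ =
      ∑ κ : Fin (n + 1) → Fin 4, (∏ j, (4 : ℂ)⁻¹ * starRingEnd ℂ (polarSign (κ j))) *
        ∏ j, ⟪u j + polarSign (κ j) • v j, A j ω (u j + polarSign (κ j) • v j)⟫_ℂ := by
    intro ω
    rw [Finset.prod_congr rfl fun j _ => inner_eq_sum_polar (A j ω) (u j) (v j),
      Finset.prod_univ_sum, Fintype.piFinset_univ]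
    exact Finset.sum_congr rfl fun κ _ => Finset.prod_mul_distrib
  simp_rw [h]
  rw [integral_finsetSum]
  · simp_rw [integral_const_mul, integral_prod_inner_self_eq hx ha hC hA hφ]
  · intro κ _
    refine Integrable.const_mul ?_ _
    refine Integrable.of_bound (C := ∏ j, (‖u j + polarSign (κ j) • v j‖ *
      ((4 * C) * ‖u j + polarSign (κ j) • v j‖))) ?_ (Eventually.of_forall fun ω => ?_)
    · exact Finset.aestronglyMeasurable_fun_prod _ fun j _ =>
        (isWeakBdd_of_isBorelCalculus hx (ha j) (hC j) (hA j)).1 _ _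
    · rw [norm_prod]
      refine Finset.prod_le_prod (fun _ _ => norm_nonneg _) fun j _ => ?_
      refine (norm_inner_le_norm _ _).trans ?_
      gcongr
      exact (A j ω).le_of_opNorm_le ((hA j ω).norm_le hx fun t => hC j _) _

/-- A weighted weak integral of `A_0 V_1 A_1 ⋯ V_n A_n` is determined by the weighted integrals of
the products of matrix coefficients of the `A_j`. -/
lemma integral_altProd_congr {ι : Type*} [Countable ι] (e : HilbertBasis ι ℂ H) {Ω Ω' : Type*}
    [MeasurableSpace Ω] [MeasurableSpace Ω'] {ν : Measure Ω} {ν' : Measure Ω'}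
    [IsFiniteMeasure ν] [IsFiniteMeasure ν'] {n : ℕ}
    {A : Fin (n + 1) → Ω → H →L[ℂ] H} {A' : Fin (n + 1) → Ω' → H →L[ℂ] H}
    (hA : ∀ j, IsWeakBdd ν (A j)) (hA' : ∀ j, IsWeakBdd ν' (A' j))
    {ρ : Ω → ℂ} {ρ' : Ω' → ℂ} (hρ : AEStronglyMeasurable ρ ν) (hρ' : AEStronglyMeasurable ρ' ν')
    {C : ℝ} (hC : ∀ ω, ‖ρ ω‖ ≤ C) (hC' : ∀ ω, ‖ρ' ω‖ ≤ C)
    (h : ∀ u v : Fin (n + 1) → H, ∫ ω, ρ ω * ∏ j, ⟪u j, A j ω (v j)⟫_ℂ ∂ν =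
      ∫ ω, ρ' ω * ∏ j, ⟪u j, A' j ω (v j)⟫_ℂ ∂ν')
    (V : Fin n → H →L[ℂ] H) (η ξ : H) :
    ∫ ω, ρ ω * ⟪η, altProd (fun j => A j ω) V ξ⟫_ℂ ∂ν =
      ∫ ω, ρ' ω * ⟪η, altProd (fun j => A' j ω) V ξ⟫_ℂ ∂ν' := by
  induction n generalizing ρ ρ' C η with
  | zero =>
    simpa [altProd_zero] using h (fun _ => η) (fun _ => ξ)
  | succ n ih =>
    refine tendsto_nhds_unique (tendsto_sum_integral_altProd e hA hρ hC V η ξ) ?_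
    convert tendsto_sum_integral_altProd e hA' hρ' hC' V η ξ using 3 with s i hi
    obtain ⟨D, hD⟩ := (hA 0).2
    obtain ⟨D', hD'⟩ := (hA' 0).2
    have hC0 : 0 ≤ max C 0 := le_max_right _ _
    -- The coefficient of `A_0` moves into the weight, and the new left vector is `V_0^* e_i`; hence
    -- the induction is over all weights and all `η`.
    refine ih (fun j => hA j.succ) (fun j => hA' j.succ) (ρ := fun ω => ρ ω * ⟪η, A 0 ω (e i)⟫_ℂ)
      (ρ' := fun ω => ρ' ω * ⟪η, A' 0 ω (e i)⟫_ℂ) (hρ.mul ((hA 0).1 η (e i)))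
      (hρ'.mul ((hA' 0).1 η (e i))) (C := max C 0 * (‖η‖ * (max D D' * ‖e i‖)))
      (fun ω => ?_) (fun ω => ?_) (fun u v => ?_) _ _
    · rw [norm_mul]
      refine mul_le_mul ((hC ω).trans (le_max_left _ _)) ?_ (norm_nonneg _) hC0
      refine (norm_inner_le_norm _ _).trans ?_
      gcongr
      exact (A 0 ω).le_of_opNorm_le ((hD ω).trans (le_max_left _ _)) _
    · rw [norm_mul]
      refine mul_le_mul ((hC' ω).trans (le_max_left _ _)) ?_ (norm_nonneg _) hC0
      refine (norm_inner_le_norm _ _).trans ?_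
      gcongr
      exact (A' 0 ω).le_of_opNorm_le ((hD' ω).trans (le_max_right _ _)) _
    · have h1 := h (Fin.cons η u) (Fin.cons (e i) v)
      simpa only [Fin.prod_univ_succ, Fin.cons_zero, Fin.cons_succ, mul_assoc] using h1

lemma IsMultOpInt.unique {ι : Type*} [Countable ι] (e : HilbertBasis ι ℂ H) {x : H →L[ℂ] H}
    (hx : IsSelfAdjoint x) {n : ℕ} {φ : (Fin (n + 1) → ℝ) → ℂ}
    {T T' : (Fin n → H →L[ℂ] H) → H →L[ℂ] H} (hT : IsMultOpInt x φ T)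
    (hT' : IsMultOpInt x φ T') : T = T' := by
  obtain ⟨Ω, _, ν, a, A, _, ha, ⟨C, hC⟩, hφ, hA, hT⟩ := hT
  obtain ⟨Ω', _, ν', a', A', _, ha', ⟨C', hC'⟩, hφ', hA', hT'⟩ := hT'
  funext V
  refine ContinuousLinearMap.ext fun ξ => ext_inner_left ℂ fun η => ?_
  rw [hT, hT']
  have h := integral_altProd_congr e
    (fun j => isWeakBdd_of_isBorelCalculus (ν := ν) hx (ha j) (hC j) (hA j))
    (fun j => isWeakBdd_of_isBorelCalculus (ν := ν') hx (ha' j) (hC' j) (hA' j))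
    (ρ := fun _ => 1) (ρ' := fun _ => 1) aestronglyMeasurable_const aestronglyMeasurable_const
    (C := 1) (by simp) (by simp) (fun u v => ?_) V η ξ
  · simpa only [one_mul] using h
  simp only [one_mul]
  rw [integral_prod_inner_eq hx ha hC hA hφ, integral_prod_inner_eq hx ha' hC' hA' hφ']

end MOI

namespace MOI

/-! ### Divided differences of exponentials and the simplex -/

/-- The divided difference at `β` of the exponential function `z ↦ e^{rz}`, written as an iterated
convolution. -/
noncomputable def expDiff : (n : ℕ) → (Fin (n + 1) → ℂ) → ℝ → ℂ
  | 0, β, r => Complex.exp (r * β 0)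
  | n + 1, β, r => ∫ q in (0 : ℝ)..r, Complex.exp (((r - q : ℝ) : ℂ) * β 0) *
      expDiff n (fun j => β j.succ) q

lemma expDiff_succ (n : ℕ) (β : Fin (n + 2) → ℂ) (r : ℝ) :
    expDiff (n + 1) β r = Complex.exp (r * β 0) *
      ∫ q in (0 : ℝ)..r, Complex.exp (-(q * β 0)) * expDiff n (fun j => β j.succ) q := by
  rw [expDiff, ← intervalIntegral.integral_const_mul]
  refine intervalIntegral.integral_congr fun q _ => ?_
  rw [← mul_assoc, ← Complex.exp_add]
  congr 2
  push_cast; ring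

lemma hasDerivAt_exp_mul (b : ℂ) (r : ℝ) :
    HasDerivAt (fun r : ℝ => Complex.exp (r * b)) (Complex.exp (r * b) * b) r := by
  have h := ((hasDerivAt_id (r : ℂ)).mul_const b).cexp.comp_ofReal
  simpa using h

lemma continuous_expDiff (n : ℕ) (β : Fin (n + 1) → ℂ) : Continuous (expDiff n β) := by
  induction n with
  | zero =>
    change Continuous fun r : ℝ => Complex.exp (r * β 0)
    fun_prop
  | succ n ih =>
    rw [show expDiff (n + 1) β = _ from funext (expDiff_succ n β)]
    refine Continuous.mul (by fun_prop) ?_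
    refine intervalIntegral.continuous_primitive (fun a b => Continuous.intervalIntegrable ?_ a b) 0
    have := ih (fun j => β j.succ)
    fun_prop

lemma hasDerivAt_expDiff_succ (n : ℕ) (β : Fin (n + 2) → ℂ) (r : ℝ) :
    HasDerivAt (expDiff (n + 1) β)
      (β 0 * expDiff (n + 1) β r + expDiff n (fun j => β j.succ) r) r := by
  have hc : Continuous fun q : ℝ => Complex.exp (-(q * β 0)) * expDiff n (fun j => β j.succ) q := by
    have := continuous_expDiff n (fun j => β j.succ)
    fun_prop
  have h := (hasDerivAt_exp_mul (β 0) r).mul (hc.integral_hasStrictDerivAt 0 r).hasDerivAt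
  rw [show expDiff (n + 1) β = _ from funext (expDiff_succ n β)]
  refine h.congr_deriv ?_
  rw [← mul_assoc (Complex.exp _) (Complex.exp _), ← Complex.exp_add, add_neg_cancel,
    Complex.exp_zero, one_mul]
  ring

lemma hasDerivAt_expDiff_zero (β : Fin 1 → ℂ) (r : ℝ) :
    HasDerivAt (expDiff 0 β) (β 0 * expDiff 0 β r) r := by
  have h := hasDerivAt_exp_mul (β 0) r
  rw [mul_comm] at h
  exact h

lemma expDiff_succ_apply_zero (n : ℕ) (β : Fin (n + 2) → ℂ) : expDiff (n + 1) β 0 = 0 := by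
  simp [expDiff]

lemma eq_zero_of_hasDerivAt_mul {D : ℝ → ℂ} {b : ℂ} (h : ∀ r, HasDerivAt D (b * D r) r)
    (h0 : D 0 = 0) (r : ℝ) : D r = 0 := by
  have h1 : ∀ r : ℝ, HasDerivAt (fun r : ℝ => Complex.exp (r * (-b)) * D r) 0 r := fun r =>
    ((hasDerivAt_exp_mul (-b) r).mul (h r)).congr_deriv (by ring)
  have h2 := is_const_of_deriv_eq_zero (fun r => (h1 r).differentiableAt) (fun r => (h1 r).deriv)
    r 0
  simp only [h0, mul_zero] at h2
  exact (mul_eq_zero.mp h2).resolve_left (Complex.exp_ne_zero _)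

/-- The recursion of divided differences. As functions of `r`, the two sides differ by a solution of
`D' = β_0 D`, `D(0) = 0`; the inhomogeneous terms cancel by the same identity for the tail of `β`.
-/
lemma sub_mul_expDiff_succ (n : ℕ) (β : Fin (n + 2) → ℂ) (r : ℝ) :
    (β 0 - β (Fin.last (n + 1))) * expDiff (n + 1) β r =
      expDiff n (fun j => β j.castSucc) r - expDiff n (fun j => β j.succ) r := by
  rw [← sub_eq_zero]
  revert r
  induction n with
  | zero =>
    refine eq_zero_of_hasDerivAt_mul (b := β 0) (fun r => ?_) ?_
    · refine (((hasDerivAt_expDiff_succ 0 β r).const_mul (β 0 - β (Fin.last 1))).sub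
        ((hasDerivAt_expDiff_zero (fun j => β j.castSucc) r).sub
          (hasDerivAt_expDiff_zero (fun j => β j.succ) r))).congr_deriv ?_
      simp only [Fin.castSucc_zero, Fin.succ_zero_eq_one, show Fin.last (0 + 1) = 1 from rfl]
      ring
    · rw [expDiff_succ_apply_zero]; simp [expDiff]
  | succ n ih =>
    refine eq_zero_of_hasDerivAt_mul (b := β 0) (fun r => ?_) ?_
    · refine (((hasDerivAt_expDiff_succ (n + 1) β r).const_mul (β 0 - β (Fin.last (n + 2)))).sub
        ((hasDerivAt_expDiff_succ n (fun j => β j.castSucc) r).sub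
          (hasDerivAt_expDiff_succ n (fun j => β j.succ) r))).congr_deriv ?_
      have h := ih (fun j => β j.succ) r
      simp only [Fin.castSucc_zero, Fin.succ_zero_eq_one, Fin.succ_last, Fin.succ_castSucc] at h ⊢
      linear_combination h
    · simp only [expDiff_succ_apply_zero]; ring

/-- A finite measure space with barycentric coordinates `lam` which represents the measure on the
standard simplex: the divided differences of exponentials are averages of exponentials over
convex combinations of the points. -/
lemma exists_simplex (n : ℕ) : ∃ (Ω : Type) (_ : MeasurableSpace Ω) (ν : Measure Ω)
    (lam : Fin (n + 1) → Ω → ℝ), IsFiniteMeasure ν ∧ (∀ j, Measurable (lam j)) ∧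
      (∀ᵐ ω ∂ν, (∀ j, 0 ≤ lam j ω) ∧ ∑ j, lam j ω = 1) ∧
      ∀ (β : Fin (n + 1) → ℂ) (r : ℝ), 0 ≤ r →
        expDiff n β r = r ^ n * ∫ ω, Complex.exp (r * ∑ j, lam j ω * β j) ∂ν := by
  induction n with
  | zero =>
    refine ⟨Unit, inferInstance, Measure.dirac (), fun _ _ => 1, inferInstance,
      fun _ => measurable_const, by simp, fun β r _ => by simp [expDiff]⟩
  | succ n ih =>
    obtain ⟨Ω, _, ν, lam, _, hm, hlam, h⟩ := ih
    -- The `(n+1)`-simplex is a cone over the `n`-simplex: coordinates `(1 - t, tλ)`, with Jacobian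
    -- `t^n`.
    let τ : Measure ℝ := (volume.restrict (Ioc 0 1)).withDensity
      fun t => ((Real.toNNReal t ^ n : NNReal) : ENNReal)
    have hτm : Measurable fun t : ℝ => Real.toNNReal t ^ n := by fun_prop
    have hτac : ∀ᵐ t ∂τ, t ∈ Ioc (0 : ℝ) 1 :=
      (withDensity_absolutelyContinuous _ _).ae_le (ae_restrict_mem measurableSet_Ioc)
    have hτ : IsFiniteMeasure τ := by
      refine isFiniteMeasure_withDensity (ne_of_lt ?_)
      calc ∫⁻ t in Ioc (0 : ℝ) 1, ((Real.toNNReal t ^ n : NNReal) : ENNReal)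
          ≤ ∫⁻ _ in Ioc (0 : ℝ) 1, 1 := by
            refine setLIntegral_mono measurable_const fun t ht => ?_
            exact_mod_cast pow_le_one₀ zero_le (Real.toNNReal_le_one.mpr ht.2)
        _ < ⊤ := by simp
    refine ⟨ℝ × Ω, inferInstance, τ.prod ν,
      Fin.cons (fun p => 1 - p.1) (fun j p => p.1 * lam j p.2), inferInstance, ?_, ?_, ?_⟩
    · refine Fin.cases ?_ fun j => ?_
      · simp only [Fin.cons_zero]; fun_prop
      · simp only [Fin.cons_succ]; exact measurable_fst.mul ((hm j).comp measurable_snd)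
    · have h1 : ∀ᵐ p ∂(τ.prod ν), p.1 ∈ Ioc (0 : ℝ) 1 :=
        Measure.quasiMeasurePreserving_fst.ae hτac
      have h2 : ∀ᵐ p ∂(τ.prod ν), (∀ j, 0 ≤ lam j p.2) ∧ ∑ j, lam j p.2 = 1 :=
        Measure.quasiMeasurePreserving_snd.ae hlam
      filter_upwards [h1, h2] with p hp hq
      refine ⟨fun j => ?_, ?_⟩
      · refine Fin.cases ?_ (fun j => ?_) j
        · simpa using hp.2
        · simpa using mul_nonneg hp.1.le (hq.1 j)
      · rw [Fin.sum_univ_succ]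
        simp only [Fin.cons_zero, Fin.cons_succ, ← Finset.mul_sum, hq.2]
        ring
    · intro β r hr
      have hsum : ∀ p : ℝ × Ω, ∑ j, ((Fin.cons (fun p => 1 - p.1)
          (fun j p => p.1 * lam j p.2) : Fin (n + 2) → ℝ × Ω → ℝ) j p : ℂ) * β j =
          (1 - p.1) * β 0 + p.1 * ∑ j, lam j p.2 * β j.succ := by
        intro p
        rw [Fin.sum_univ_succ]
        simp only [Fin.cons_zero, Fin.cons_succ, Finset.mul_sum]
        push_cast
        simp only [mul_assoc]
      simp_rw [hsum]
      have hmeas : Measurable fun p : ℝ × Ω => Complex.exp (r * ((1 - p.1) * β 0 + p.1 *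
          ∑ j, lam j p.2 * β j.succ)) := by
        have h3 : Measurable fun p : ℝ × Ω => ∑ j, (lam j p.2 : ℂ) * β j.succ :=
          Finset.measurable_fun_sum _ fun j _ =>
            (Complex.measurable_ofReal.comp ((hm j).comp measurable_snd)).mul_const _
        fun_prop
      rw [integral_prod]
      · rw [integral_withDensity_eq_integral_smul hτm, ← intervalIntegral.integral_of_le zero_le_one]
        -- The substitution `q = rt` in the convolution; this is why the statement is proved for all
        -- `r ≥ 0` and not only `r = 1`.
        have h4 := intervalIntegral.smul_integral_comp_mul_left (a := 0) (b := 1)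
          (fun q : ℝ => Complex.exp (((r - q : ℝ) : ℂ) * β 0) *
            expDiff n (fun j => β j.succ) q) r
        rw [mul_zero, mul_one] at h4
        rw [expDiff, ← h4, pow_succ, mul_comm ((r : ℂ) ^ n) (r : ℂ), mul_assoc,
          ← intervalIntegral.integral_const_mul, Complex.real_smul]
        congr 1
        refine intervalIntegral.integral_congr fun t ht => ?_
        rw [uIcc_of_le zero_le_one] at ht
        simp only
        rw [h _ _ (mul_nonneg hr ht.1), NNReal.smul_def, NNReal.coe_pow, Real.coe_toNNReal _ ht.1,
          Complex.real_smul, ← mul_assoc, mul_comm (Complex.exp _), mul_assoc,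
          ← integral_const_mul, ← mul_assoc]
        push_cast
        rw [mul_pow]
        congr 1
        refine integral_congr_ae (Eventually.of_forall fun ω => ?_)
        simp only
        rw [← Complex.exp_add]
        congr 1
        ring
      · refine Integrable.of_bound (C := Real.exp (r * ∑ j, ‖β j‖)) hmeas.aestronglyMeasurable ?_
        have h1 : ∀ᵐ p ∂(τ.prod ν), p.1 ∈ Ioc (0 : ℝ) 1 :=
          Measure.quasiMeasurePreserving_fst.ae hτac
        have h2 : ∀ᵐ p ∂(τ.prod ν), (∀ j, 0 ≤ lam j p.2) ∧ ∑ j, lam j p.2 = 1 :=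
          Measure.quasiMeasurePreserving_snd.ae hlam
        filter_upwards [h1, h2] with p hp hq
        have h5 : ∀ j, lam j p.2 ≤ 1 := fun j =>
          hq.2 ▸ Finset.single_le_sum (fun i _ => hq.1 i) (Finset.mem_univ j)
        refine (Complex.norm_exp_le_exp_norm _).trans (Real.exp_le_exp.mpr ?_)
        rw [norm_mul, Complex.norm_real, Real.norm_of_nonneg hr,
          Fin.sum_univ_succ (fun j => ‖β j‖)]
        refine mul_le_mul_of_nonneg_left ((norm_add_le _ _).trans (add_le_add ?_ ?_)) hr
        · rw [norm_mul]
          refine mul_le_of_le_one_left (norm_nonneg _) ?_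
          rw [← Complex.ofReal_one, ← Complex.ofReal_sub, Complex.norm_real, Real.norm_eq_abs,
            abs_le]
          constructor <;> linarith [hp.1, hp.2]
        · rw [norm_mul, Complex.norm_real, Real.norm_of_nonneg hp.1.le]
          refine (mul_le_of_le_one_left (norm_nonneg _) hp.2).trans ((norm_sum_le _ _).trans ?_)
          refine Finset.sum_le_sum fun j _ => ?_
          rw [norm_mul, Complex.norm_real, Real.norm_of_nonneg (hq.1 j)]
          exact mul_le_of_le_one_left (norm_nonneg _) (h5 j)

end MOI

namespace MOI

/-! ### The Hermite–Genocchi formula -/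

/-- `(ν, lam)` represents the measure on the standard `n`-simplex. -/
structure IsSimplex (n : ℕ) {Ω : Type*} [MeasurableSpace Ω] (ν : Measure Ω)
    (lam : Fin (n + 1) → Ω → ℝ) : Prop where
  measurable : ∀ j, Measurable (lam j)
  ae_nonneg : ∀ᵐ ω ∂ν, ∀ j, 0 ≤ lam j ω
  ae_sum : ∀ᵐ ω ∂ν, ∑ j, lam j ω = 1
  expDiff_eq : ∀ β : Fin (n + 1) → ℂ, expDiff n β 1 = ∫ ω, Complex.exp (∑ j, lam j ω * β j) ∂ν

lemma exists_isSimplex (n : ℕ) : ∃ (Ω : Type) (_ : MeasurableSpace Ω) (ν : Measure Ω)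
    (lam : Fin (n + 1) → Ω → ℝ), IsFiniteMeasure ν ∧ IsSimplex n ν lam := by
  obtain ⟨Ω, _, ν, lam, h1, h2, h3, h4⟩ := exists_simplex n
  exact ⟨Ω, _, ν, lam, h1, h2, h3.mono fun _ h => h.1, h3.mono fun _ h => h.2,
    fun β => by simpa using h4 β 1 zero_le_one⟩

/-- The `n`-th derivative of a Schwartz function. -/
noncomputable def iterDeriv (n : ℕ) (g : 𝓢(ℝ, ℂ)) : 𝓢(ℝ, ℂ) := (SchwartzMap.derivCLM ℂ ℂ)^[n] g

lemma iterDeriv_zero (g : 𝓢(ℝ, ℂ)) : iterDeriv 0 g = g := rfl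

lemma coe_iterDeriv (n : ℕ) (g : 𝓢(ℝ, ℂ)) : ⇑(iterDeriv n g) = iteratedDeriv n g := by
  induction n with
  | zero => simp [iterDeriv]
  | succ n ih =>
    rw [iterDeriv, Function.iterate_succ_apply', iteratedDeriv_succ, ← ih]
    rfl

lemma iterDeriv_iterDeriv (m n : ℕ) (g : 𝓢(ℝ, ℂ)) :
    iterDeriv m (iterDeriv n g) = iterDeriv (m + n) g :=
  (Function.iterate_add_apply _ m n g).symm

lemma hasDerivAt_iterDeriv (n : ℕ) (g : 𝓢(ℝ, ℂ)) (u : ℝ) :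
    HasDerivAt (iterDeriv n g) (iterDeriv (n + 1) g u) u := by
  have h : iterDeriv (n + 1) g u = deriv (iterDeriv n g) u := by
    rw [iterDeriv, Function.iterate_succ_apply']; rfl
  rw [h]
  exact ((iterDeriv n g).differentiable u).hasDerivAt

open FourierTransform in
lemma fourier_iterDeriv (n : ℕ) (g : 𝓢(ℝ, ℂ)) (ξ : ℝ) :
    𝓕 (iterDeriv n g) ξ = (2 * Real.pi * Complex.I * ξ) ^ n * 𝓕 g ξ := by
  have h := congrFun (Real.fourier_iteratedDeriv (f := g) (N := ⊤) (n := n) (g.smooth ⊤)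
    (fun m _ => by rw [← coe_iterDeriv]; exact (iterDeriv m g).integrable) le_top) ξ
  rw [← coe_iterDeriv] at h
  simpa [SchwartzMap.fourier_coe] using h

open FourierTransform in
lemma eq_integral_fourier (g : 𝓢(ℝ, ℂ)) (u : ℝ) :
    g u = ∫ ξ, 𝓕 g ξ * Complex.exp (2 * Real.pi * Complex.I * ξ * u) := by
  have h : 𝓕⁻ (𝓕 g) = g := FourierTransform.fourierInv_fourier_eq g
  conv_lhs => rw [← h]
  rw [SchwartzMap.fourierInv_coe, Real.fourierInv_eq']
  refine integral_congr_ae (Eventually.of_forall fun ξ => ?_)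
  simp only [smul_eq_mul]
  rw [mul_comm]
  congr 2
  simp
  ring

/-- Moving `α_j` to `α_j + tj` makes a given pair collide for at most one `t`, so small `t ≠ 0`
separate all points. This makes the extension by continuity meaningful at every tuple. -/
lemma mem_closure_injective {n : ℕ} (α : Fin n → ℝ) :
    α ∈ closure {α : Fin n → ℝ | Function.Injective α} := by
  have h1 : Tendsto (fun t : ℝ => fun j : Fin n => α j + t * (j : ℕ)) (𝓝[≠] 0) (𝓝 α) := by
    refine tendsto_nhdsWithin_of_tendsto_nhds ?_
    have : Continuous fun t : ℝ => fun j : Fin n => α j + t * ((j : ℕ) : ℝ) := by fun_prop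
    simpa using this.tendsto 0
  refine mem_closure_of_tendsto h1 ?_
  have h2 : ∀ᶠ t in 𝓝[≠] (0 : ℝ), ∀ i j : Fin n, i ≠ j → α i + t * (i : ℕ) ≠ α j + t * (j : ℕ) := by
    refine eventually_all.mpr fun i => eventually_all.mpr fun j => ?_
    by_cases hij : i = j
    · simp [hij]
    have hne : ((i : ℕ) : ℝ) - ((j : ℕ) : ℝ) ≠ 0 :=
      sub_ne_zero.mpr (Nat.cast_injective.ne (Fin.val_injective.ne hij))
    have h3 : ∀ᶠ t in 𝓝[≠] (0 : ℝ), t ≠ (α j - α i) / ((i : ℕ) - (j : ℕ)) := by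
      by_cases h0 : (α j - α i) / (((i : ℕ) : ℝ) - (j : ℕ)) = 0
      · rw [h0]; exact self_mem_nhdsWithin
      · exact nhdsWithin_le_nhds (isOpen_ne.mem_nhds (Ne.symm h0))
    filter_upwards [h3] with t ht _ h4
    refine ht ?_
    rw [eq_div_iff hne]
    linarith
  filter_upwards [h2] with t ht i j hij
  by_contra hne
  exact ht i j hne hij

open FourierTransform in
lemma integrable_fourier_mul_pow (g : 𝓢(ℝ, ℂ)) (n : ℕ) {w : ℝ → ℂ} (hw : AEStronglyMeasurable w)
    {C : ℝ} (hC : ∀ ξ, ‖w ξ‖ ≤ C) :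
    Integrable fun ξ : ℝ => (2 * Real.pi * Complex.I * ξ) ^ n * 𝓕 g ξ * w ξ := by
  have h := ((𝓕 (iterDeriv n g)).integrable (μ := volume)).congr
    (Eventually.of_forall (fourier_iterDeriv n g))
  exact h.mul_bdd hw (Eventually.of_forall hC)

variable {n : ℕ} {Ω : Type*} [MeasurableSpace Ω] {ν : Measure Ω} [IsFiniteMeasure ν]
  {lam : Fin (n + 1) → Ω → ℝ}

lemma norm_exp_imag (a b : ℝ) : ‖Complex.exp (2 * Real.pi * Complex.I * a * b)‖ = 1 := by
  rw [show 2 * Real.pi * Complex.I * a * b = ((2 * Real.pi * a * b : ℝ) : ℂ) * Complex.I by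
    push_cast; ring]
  exact Complex.norm_exp_ofReal_mul_I _

lemma IsSimplex.expDiff_imag (h : IsSimplex n ν lam) (ξ : ℝ) (α : Fin (n + 1) → ℝ) :
    expDiff n (fun j => 2 * Real.pi * Complex.I * ξ * α j) 1 =
      ∫ ω, Complex.exp (2 * Real.pi * Complex.I * ξ * (∑ j, lam j ω * α j : ℝ)) ∂ν := by
  rw [h.expDiff_eq]
  refine integral_congr_ae (Eventually.of_forall fun ω => ?_)
  simp only
  congr 1
  push_cast
  rw [Finset.mul_sum]
  exact Finset.sum_congr rfl fun j _ => by ring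

lemma IsSimplex.measurable_sum (h : IsSimplex n ν lam) (α : Fin (n + 1) → ℝ) :
    Measurable fun ω => ∑ j, lam j ω * α j :=
  Finset.measurable_fun_sum _ fun j _ => (h.measurable j).mul_const _

/-- At imaginary arguments the simplex average is one of unimodular exponentials, hence bounded by
the mass of the simplex. -/
lemma expDiff_imag_bound (n : ℕ) (α : Fin (n + 1) → ℝ) :
    AEStronglyMeasurable (fun ξ : ℝ => expDiff n (fun j => 2 * Real.pi * Complex.I * ξ * α j) 1) ∧
    ∃ C, ∀ ξ : ℝ, ‖expDiff n (fun j => 2 * Real.pi * Complex.I * ξ * α j) 1‖ ≤ C := by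
  obtain ⟨Ω, _, ν, lam, _, h⟩ := exists_isSimplex n
  refine ⟨?_, ν.real univ, fun ξ => ?_⟩
  · simp_rw [h.expDiff_imag]
    have hm := h.measurable_sum α
    have hm2 : Measurable fun p : ℝ × Ω =>
        Complex.exp (2 * Real.pi * Complex.I * p.1 * (∑ j, lam j p.2 * α j : ℝ)) := by
      have : Measurable fun p : ℝ × Ω => ∑ j, lam j p.2 * α j := hm.comp measurable_snd
      fun_prop
    exact hm2.stronglyMeasurable.integral_prod_right'.aestronglyMeasurable
  · rw [h.expDiff_imag]
    refine (norm_integral_le_of_norm_le_const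
      (Eventually.of_forall fun ω => (norm_exp_imag _ _).le)).trans ?_
    simp

-- Fourier inversion reduces to exponentials: the factor `(2πiξ)^{n+1}` absorbs the denominator in
-- `sub_mul_expDiff_succ`.
open FourierTransform in
lemma divDiffAux_eq_integral (g : 𝓢(ℝ, ℂ)) (n : ℕ) (α : Fin (n + 1) → ℝ)
    (hα : Function.Injective α) :
    divDiffAux g n α = ∫ ξ : ℝ, (2 * Real.pi * Complex.I * ξ) ^ n * 𝓕 g ξ *
      expDiff n (fun j => 2 * Real.pi * Complex.I * ξ * α j) 1 := by
  induction n with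
  | zero =>
    rw [divDiffAux, eq_integral_fourier]
    simp [expDiff]
  | succ n ih =>
    rw [divDiffAux, ih (fun j => α j.castSucc) (hα.comp (Fin.castSucc_injective _)),
      ih (fun j => α j.succ) (hα.comp (Fin.succ_injective _)), ← integral_sub, div_eq_iff, ← integral_mul_const]
    · refine integral_congr_ae (Eventually.of_forall fun ξ => ?_)
      have h := sub_mul_expDiff_succ n (fun j => 2 * Real.pi * Complex.I * ξ * α j) 1
      simp only
      rw [← mul_sub, ← h]
      push_cast
      ring
    · rw [Complex.ofReal_ne_zero, sub_ne_zero]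
      exact hα.ne (Fin.last_pos.ne)
    · obtain ⟨h1, C, h2⟩ := expDiff_imag_bound n (fun j => α j.castSucc)
      exact integrable_fourier_mul_pow g n h1 h2
    · obtain ⟨h1, C, h2⟩ := expDiff_imag_bound n (fun j => α j.succ)
      exact integrable_fourier_mul_pow g n h1 h2

-- Fubini, followed by Fourier inversion for `g^{(n)}`, whose transform is `(2πiξ)^n 𝓕 g`.
open FourierTransform in
lemma IsSimplex.divDiffAux_eq (h : IsSimplex n ν lam) (g : 𝓢(ℝ, ℂ)) (α : Fin (n + 1) → ℝ)
    (hα : Function.Injective α) :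
    divDiffAux g n α = ∫ ω, iterDeriv n g (∑ j, lam j ω * α j) ∂ν := by
  rw [divDiffAux_eq_integral g n α hα]
  simp_rw [h.expDiff_imag, ← integral_const_mul]
  rw [integral_integral_swap]
  · refine integral_congr_ae (Eventually.of_forall fun ω => ?_)
    simp only
    rw [eq_integral_fourier (iterDeriv n g)]
    simp_rw [fourier_iterDeriv]
  · have h1 := ((𝓕 (iterDeriv n g)).integrable (μ := volume)).congr
      (Eventually.of_forall (fourier_iterDeriv n g))
    have hm := h.measurable_sum α
    have hm2 : Measurable fun p : ℝ × Ω =>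
        Complex.exp (2 * Real.pi * Complex.I * p.1 * (∑ j, lam j p.2 * α j : ℝ)) := by
      have : Measurable fun p : ℝ × Ω => ∑ j, lam j p.2 * α j := hm.comp measurable_snd
      fun_prop
    exact (h1.comp_fst ν).mul_bdd hm2.aestronglyMeasurable
      (Eventually.of_forall fun p => (norm_exp_imag _ _).le)

lemma IsSimplex.continuous_integral (h : IsSimplex n ν lam) (g : 𝓢(ℝ, ℂ)) :
    Continuous fun α : Fin (n + 1) → ℝ => ∫ ω, g (∑ j, lam j ω * α j) ∂ν := by
  obtain ⟨C, -, hC⟩ := g.decay 0 0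
  refine continuous_of_dominated (bound := fun _ => C) (fun α => ?_)
    (fun α => Eventually.of_forall fun ω => ?_) (integrable_const _)
    (Eventually.of_forall fun ω => ?_)
  · exact (g.continuous.measurable.comp (h.measurable_sum α)).aestronglyMeasurable
  · simpa using hC (∑ j, lam j ω * α j)
  · have := g.continuous
    fun_prop

/-- The **Hermite–Genocchi formula**. -/
lemma IsSimplex.divDiff_eq (h : IsSimplex n ν lam) (g : 𝓢(ℝ, ℂ)) (α : Fin (n + 1) → ℝ) :
    divDiff g n α = ∫ ω, iterDeriv n g (∑ j, lam j ω * α j) ∂ν := by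
  refine extendFrom_eq (mem_closure_injective α) ?_
  have h1 := (h.continuous_integral (iterDeriv n g)).continuousWithinAt
    (s := {α : Fin (n + 1) → ℝ | Function.Injective α}) (x := α)
  refine Tendsto.congr' ?_ h1
  filter_upwards [self_mem_nhdsWithin] with β hβ
  exact (h.divDiffAux_eq g β hβ).symm

lemma divDiffAux_congr {f g : ℝ → ℂ} {U : Set ℝ} (hfg : EqOn f g U) (n : ℕ)
    (α : Fin (n + 1) → ℝ) (hα : ∀ j, α j ∈ U) : divDiffAux f n α = divDiffAux g n α := by
  induction n with
  | zero => exact hfg (hα 0)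
  | succ n ih => rw [divDiffAux, divDiffAux, ih _ fun j => hα _, ih _ fun j => hα _]

/-- The extension by continuity looks at neighbouring tuples, so agreement on an open set is
required. This allows `F`, controlled only on `(0, ∞)`, to be exchanged for a Schwartz function. -/
lemma divDiff_congr {f g : ℝ → ℂ} {U : Set ℝ} (hU : IsOpen U) (hfg : EqOn f g U) (n : ℕ)
    (α : Fin (n + 1) → ℝ) (hα : ∀ j, α j ∈ U) : divDiff f n α = divDiff g n α := by
  unfold divDiff extendFrom limUnder
  congr 1
  refine Filter.map_congr ?_
  have h : ∀ᶠ β in 𝓝 α, ∀ j, β j ∈ U := eventually_all.mpr fun j =>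
    (continuous_apply j).continuousAt.eventually (hU.mem_nhds (hα j))
  filter_upwards [nhdsWithin_le_nhds h] with β hβ
  exact divDiffAux_congr hfg n β hβ

end MOI

namespace MOI

/-! ### Multiple operator integrals of exponential type -/

/-- The element `e^{iyx}` of a complex Banach algebra. -/
noncomputable def expI {A : Type*} [NormedRing A] [NormedAlgebra ℂ A] (x : A) (y : ℝ) : A :=
  NormedSpace.exp ((y * Complex.I : ℂ) • x)

lemma continuous_expI {A : Type*} [NormedRing A] [NormedAlgebra ℂ A] [CompleteSpace A] (x : A) :
    Continuous (expI x) := by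
  let +nondep : NormedAlgebra ℚ A := NormedAlgebra.restrictScalars ℚ ℂ A
  exact NormedSpace.exp_continuous.comp (by fun_prop)

variable {H : Type*} [NormedAddCommGroup H] [InnerProductSpace ℂ H] [CompleteSpace H]

/-- Spectral measures are tested on real functions only, so the exponential is split into cosine and
sine. -/
lemma expI_eq_cfc {x : H →L[ℂ] H} (hx : IsSelfAdjoint x) (y : ℝ) :
    expI x y = cfc (fun t : ℝ => Real.cos (y * t)) x +
      Complex.I • cfc (fun t : ℝ => Real.sin (y * t)) x := by
  have hn : IsStarNormal x := hx.isStarNormal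
  have hn2 : IsStarNormal ((y * Complex.I : ℂ) • x) := by
    refine ⟨?_⟩
    rw [star_smul, hx.star_eq]
    exact ((Commute.refl x).smul_left _).smul_right _
  rw [expI, ← CFC.exp_eq_normedSpace_exp (𝕜 := ℂ) (a := (y * Complex.I : ℂ) • x),
    cfc_real_eq_complex _ hx, cfc_real_eq_complex _ hx, ← cfc_smul .., ← cfc_add ..,
    ← cfc_comp_smul (y * Complex.I : ℂ) _ x]
  · refine cfc_congr fun z hz => ?_
    have hz' : z = (z.re : ℂ) := hx.mem_spectrum_eq_re hz
    rw [hz']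
    simp only [Complex.ofReal_re, smul_eq_mul, ← Complex.exp_eq_exp_ℂ]
    rw [show (y : ℂ) * Complex.I * z.re = ((y * z.re : ℝ) : ℂ) * Complex.I by push_cast; ring,
      Complex.exp_mul_I]
    push_cast
    ring

lemma isBorelCalculus_smul_expI {x : H →L[ℂ] H} (hx : IsSelfAdjoint x) (q : ℂ) (y : ℝ) :
    IsBorelCalculus x (fun t => q * Complex.exp ((y * t : ℝ) * Complex.I)) (q • expI x y) := by
  intro ξ
  have hμ := isSpectralMeasure_spectralMeasure hx ξ
  refine ⟨spectralMeasure hx ξ, hμ, ?_⟩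
  let gc : ℝ →ᵇ ℝ := BoundedContinuousFunction.ofNormedAddCommGroup
    (fun t => Real.cos (y * t)) (by fun_prop) 1 (fun t => Real.abs_cos_le_one _)
  let gs : ℝ →ᵇ ℝ := BoundedContinuousFunction.ofNormedAddCommGroup
    (fun t => Real.sin (y * t)) (by fun_prop) 1 (fun t => Real.abs_sin_le_one _)
  have hc := hμ.2 gc
  have hs := hμ.2 gs
  have hci := gc.integrable (spectralMeasure hx ξ)
  have hsi := gs.integrable (spectralMeasure hx ξ)
  simp only [gc, gs, BoundedContinuousFunction.coe_ofNormedAddCommGroup] at hc hs hci hsi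
  rw [expI_eq_cfc hx, integral_const_mul]
  simp only [smul_apply, add_apply, inner_smul_right, inner_add_right, hc, hs]
  congr 1
  rw [← integral_complex_ofReal, ← integral_complex_ofReal, ← integral_const_mul,
    ← integral_add hci.ofReal (hsi.ofReal.const_mul _)]
  refine integral_congr_ae (Eventually.of_forall fun t => ?_)
  simp only
  rw [Complex.exp_mul_I]
  push_cast
  ring

lemma norm_expI_le {x : H →L[ℂ] H} (hx : IsSelfAdjoint x) (y : ℝ) : ‖expI x y‖ ≤ 4 := by
  have h := (isBorelCalculus_smul_expI hx 1 y).norm_le hx (C := 1)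
    (fun t => by rw [one_mul]; exact (Complex.norm_exp_ofReal_mul_I _).le)
  simpa using h

lemma continuous_altProd {n : ℕ} (V : Fin n → H →L[ℂ] H) :
    Continuous fun A : Fin (n + 1) → H →L[ℂ] H => altProd A V := by
  induction n with
  | zero =>
    simp only [altProd_zero]
    exact continuous_apply 0
  | succ n ih =>
    simp only [altProd_succ]
    have h := (ih (fun j => V j.succ)).comp
      (continuous_pi fun j : Fin (n + 1) => continuous_apply (A := fun _ => H →L[ℂ] H) j.succ)
    exact (continuous_apply 0).mul (continuous_const.mul h)

lemma norm_altProd_le {n : ℕ} (V : Fin n → H →L[ℂ] H) {C : ℝ} (hC : 0 ≤ C)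
    (A : Fin (n + 1) → H →L[ℂ] H) (hA : ∀ j, ‖A j‖ ≤ C) :
    ‖altProd A V‖ ≤ C ^ (n + 1) * ∏ j, ‖V j‖ := by
  induction n with
  | zero => simpa [altProd_zero] using hA 0
  | succ n ih =>
    rw [altProd_succ, Fin.prod_univ_succ]
    refine (norm_mul_le _ _).trans ?_
    refine (mul_le_mul (hA 0) ((norm_mul_le _ _).trans (mul_le_mul_of_nonneg_left
      (ih (fun j => V j.succ) (fun j => A j.succ) fun j => hA _) (norm_nonneg _)))
      (norm_nonneg _) hC).trans_eq ?_
    ring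

lemma altProd_smul_zero {n : ℕ} (q : ℂ) (A : Fin (n + 1) → H →L[ℂ] H) (V : Fin n → H →L[ℂ] H) :
    altProd (fun j => (if j = 0 then q else 1) • A j) V = q • altProd A V := by
  simp [altProd, Fin.succ_ne_zero]

/-- The product `e^{i y_0 x} V_1 e^{i y_1 x} ⋯ V_n e^{i y_n x}`. -/
noncomputable def expProd (x : H →L[ℂ] H) {n : ℕ} (V : Fin n → H →L[ℂ] H) (y : Fin (n + 1) → ℝ) :
    H →L[ℂ] H := altProd (fun j => expI x (y j)) V

lemma continuous_expProd (x : H →L[ℂ] H) {n : ℕ} (V : Fin n → H →L[ℂ] H) :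
    Continuous (expProd x V) :=
  (continuous_altProd V).comp (continuous_pi fun j => (continuous_expI x).comp (continuous_apply j))

lemma norm_expProd_le {x : H →L[ℂ] H} (hx : IsSelfAdjoint x) {n : ℕ} (V : Fin n → H →L[ℂ] H)
    (y : Fin (n + 1) → ℝ) : ‖expProd x V y‖ ≤ 4 ^ (n + 1) * ∏ j, ‖V j‖ :=
  norm_altProd_le V (by norm_num) _ fun _ => norm_expI_le hx _

lemma IsMultOpInt.congr {x : H →L[ℂ] H} {n : ℕ} {φ φ' : (Fin (n + 1) → ℝ) → ℂ}
    {T : (Fin n → H →L[ℂ] H) → H →L[ℂ] H} (hT : IsMultOpInt x φ T)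
    (h : ∀ α : Fin (n + 1) → ℝ, (∀ j, α j ∈ spectrum ℝ x) → φ' α = φ α) : IsMultOpInt x φ' T := by
  obtain ⟨Ω, i, ν, a, A, h1, ha, hC, hφ, hA, hT⟩ := hT
  exact ⟨Ω, i, ν, a, A, h1, ha, hC, fun α hα => (h α hα).trans (hφ α hα), hA, hT⟩

lemma IsMultOpInt.multOpInt_eq {ι : Type*} [Countable ι] (e : HilbertBasis ι ℂ H) {x : H →L[ℂ] H}
    (hx : IsSelfAdjoint x) {n : ℕ} {φ : (Fin (n + 1) → ℝ) → ℂ}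
    {T : (Fin n → H →L[ℂ] H) → H →L[ℂ] H} (hT : IsMultOpInt x φ T) (V : Fin n → H →L[ℂ] H) :
    multOpInt x φ V = T V := by
  have h : ∃ T, IsMultOpInt x φ T := ⟨T, hT⟩
  rw [multOpInt, dif_pos h, IsMultOpInt.unique e hx h.choose_spec hT]

lemma measurable_expProd (x : H →L[ℂ] H) {n : ℕ} (V : Fin n → H →L[ℂ] H) {P : Type*}
    [MeasurableSpace P] {y : Fin (n + 1) → P → ℝ} (hy : ∀ j, Measurable (y j)) :
    StronglyMeasurable fun p => expProd x V (fun j => y j p) :=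
  (continuous_expProd x V).comp_stronglyMeasurable (measurable_pi_lambda _ hy).stronglyMeasurable

lemma integrable_smul_expProd {x : H →L[ℂ] H} (hx : IsSelfAdjoint x) {n : ℕ}
    (V : Fin n → H →L[ℂ] H) {P : Type*}
    [MeasurableSpace P] {π : Measure P} [IsFiniteMeasure π] {q : P → ℂ} (hq : Measurable q) {C : ℝ}
    (hC : ∀ p, ‖q p‖ ≤ C) {y : Fin (n + 1) → P → ℝ} (hy : ∀ j, Measurable (y j)) :
    Integrable (fun p => q p • expProd x V (fun j => y j p)) π := by
  refine Integrable.of_bound (C := C * (4 ^ (n + 1) * ∏ j, ‖V j‖)) ?_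
    (Eventually.of_forall fun p => ?_)
  · exact (hq.stronglyMeasurable.smul (measurable_expProd x V hy)).aestronglyMeasurable
  · rw [norm_smul]
    exact mul_le_mul (hC p) (norm_expProd_le hx V _) (norm_nonneg _)
      ((norm_nonneg _).trans (hC p))

/-- A measurable bounded combination of exponentials defines a multiple operator integral, and its
values are Bochner integrals. -/
lemma isMultOpInt_expProd {x : H →L[ℂ] H} (hx : IsSelfAdjoint x) {n : ℕ} {P : Type}
    [MeasurableSpace P] {π : Measure P} [IsFiniteMeasure π] {q : P → ℂ} (hq : Measurable q) {C : ℝ}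
    (hC : ∀ p, ‖q p‖ ≤ C) {y : Fin (n + 1) → P → ℝ} (hy : ∀ j, Measurable (y j))
    {φ : (Fin (n + 1) → ℝ) → ℂ} (hφ : ∀ α : Fin (n + 1) → ℝ, (∀ j, α j ∈ spectrum ℝ x) →
      φ α = ∫ p, q p * Complex.exp ((∑ j, y j p * α j : ℝ) * Complex.I) ∂π) :
    IsMultOpInt x φ fun V => ∫ p, q p • expProd x V (fun j => y j p) ∂π := by
  -- The coefficient `q` is carried by the zeroth factor alone; the others are pure exponentials,
  -- whence the common bound `max C 1`.
  refine ⟨P, _, π, fun j p => (if j = 0 then q p.2 else 1) *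
      Complex.exp ((y j p.2 * p.1 : ℝ) * Complex.I),
    fun j p => (if j = 0 then q p else 1) • expI x (y j p), inferInstance, fun j => ?_,
    ⟨max C 1, fun j p => ?_⟩, fun α hα => ?_, fun j p => ?_, fun V ξ η => ?_⟩
  · have h1 : Measurable fun p : ℝ × P => y j p.2 * p.1 :=
      ((hy j).comp measurable_snd).mul measurable_fst
    have h2 : Measurable fun p : ℝ × P => Complex.exp ((y j p.2 * p.1 : ℝ) * Complex.I) := by
      fun_prop
    refine Measurable.mul ?_ h2
    by_cases hj : j = 0
    · simpa only [hj, if_true] using! hq.comp measurable_snd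
    · simp [hj]
  · rw [norm_mul, Complex.norm_exp_ofReal_mul_I, mul_one]
    by_cases hj : j = 0
    · simpa [hj] using Or.inl (hC _)
    · simp [hj]
  · rw [hφ α hα]
    refine integral_congr_ae (Eventually.of_forall fun p => ?_)
    simp only
    rw [Finset.prod_mul_distrib, Finset.prod_ite_eq' Finset.univ (0 : Fin (n + 1)),
      if_pos (Finset.mem_univ _), ← Complex.exp_sum]
    congr 2
    push_cast
    rw [Finset.sum_mul]
  · exact isBorelCalculus_smul_expI hx _ _
  · have h := ContinuousLinearMap.integral_comp_comm
      ((innerSL ℂ η).comp (ContinuousLinearMap.apply ℂ H ξ))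
      (integrable_smul_expProd (π := π) hx V hq hC hy)
    simp only [altProd_smul_zero]
    exact h.symm

end MOI

namespace MOI

/-! ### Radial integrals of Schwartz functions -/

/-- From `1 + y² ≤ max(1, 1/m) (1 + y²u)` and Schwartz decay. Uniformity in `u ≥ m` later gives
domination over the whole simplex. -/
lemma exists_decay_sq (h : 𝓢(ℝ, ℂ)) {m : ℝ} (hm : 0 < m) (k : ℕ) :
    ∃ C, ∀ u, m ≤ u → ∀ y : ℝ, (1 + y ^ 2) ^ k * ‖h (y ^ 2 * u)‖ ≤ C := by
  have h1 := SchwartzMap.one_add_le_sup_seminorm_apply (𝕜 := ℝ) (m := (k, 0)) le_rfl le_rfl h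
  set D := 2 ^ k * ((Finset.Iic (k, 0)).sup fun m => SchwartzMap.seminorm ℝ m.1 m.2) h
  refine ⟨(max 1 m⁻¹) ^ k * D, fun u hu y => ?_⟩
  have hu0 : 0 < u := hm.trans_le hu
  have h2 : 1 + y ^ 2 ≤ max 1 m⁻¹ * (1 + ‖y ^ 2 * u‖) := by
    rw [Real.norm_of_nonneg (by positivity), mul_add, mul_one]
    refine add_le_add (le_max_left _ _) ?_
    calc y ^ 2 = m⁻¹ * (y ^ 2 * m) := by field_simp
      _ ≤ max 1 m⁻¹ * (y ^ 2 * u) := by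
        gcongr
        exact le_max_right _ _
  calc (1 + y ^ 2) ^ k * ‖h (y ^ 2 * u)‖
      ≤ (max 1 m⁻¹ * (1 + ‖y ^ 2 * u‖)) ^ k * ‖h (y ^ 2 * u)‖ := by gcongr
    _ = (max 1 m⁻¹) ^ k * ((1 + ‖y ^ 2 * u‖) ^ k * ‖h (y ^ 2 * u)‖) := by rw [mul_pow, mul_assoc]
    _ ≤ _ := by
      have := h1 (y ^ 2 * u)
      rw [norm_iteratedFDeriv_zero] at this
      gcongr

lemma abs_pow_le_one_add_sq_pow (y : ℝ) (m : ℕ) : |y| ^ m ≤ (1 + y ^ 2) ^ m := by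
  refine pow_le_pow_left₀ (abs_nonneg y) ?_ m
  rw [← sq_abs]
  nlinarith [sq_nonneg (|y| - 1), abs_nonneg y]

lemma exists_bound_pow_mul (h : 𝓢(ℝ, ℂ)) {u₀ : ℝ} (hu₀ : 0 < u₀) (m k : ℕ) :
    ∃ C, ∀ u, u₀ ≤ u → ∀ y : ℝ, ‖(y : ℂ) ^ m * h (y ^ 2 * u)‖ ≤ C * ((1 + y ^ 2) ^ k)⁻¹ := by
  obtain ⟨C, hC⟩ := exists_decay_sq h hu₀ (m + k)
  refine ⟨C, fun u hu y => ?_⟩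
  have h0 : 0 < 1 + y ^ 2 := by positivity
  rw [← div_eq_mul_inv, le_div_iff₀ (by positivity), norm_mul, norm_pow, Complex.norm_real,
    Real.norm_eq_abs]
  calc |y| ^ m * ‖h (y ^ 2 * u)‖ * (1 + y ^ 2) ^ k
      ≤ (1 + y ^ 2) ^ m * ‖h (y ^ 2 * u)‖ * (1 + y ^ 2) ^ k := by
        refine mul_le_mul_of_nonneg_right (mul_le_mul_of_nonneg_right
          (abs_pow_le_one_add_sq_pow y m) (norm_nonneg _)) (by positivity)
    _ = (1 + y ^ 2) ^ (m + k) * ‖h (y ^ 2 * u)‖ := by ring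
    _ ≤ C := hC u hu y

lemma integrable_pow_mul_sq (h : 𝓢(ℝ, ℂ)) {u : ℝ} (hu : 0 < u) (m : ℕ) :
    Integrable fun y : ℝ => (y : ℂ) ^ m * h (y ^ 2 * u) := by
  obtain ⟨C, hC⟩ := exists_bound_pow_mul h hu m 1
  have hc := h.continuous
  refine Integrable.mono' (integrable_inv_one_add_sq.const_mul C)
    (Continuous.aestronglyMeasurable (by fun_prop)) (Eventually.of_forall fun y => ?_)
  simpa using hC u le_rfl y

lemma tendsto_pow_mul_sq (h : 𝓢(ℝ, ℂ)) {u : ℝ} (hu : 0 < u) (m : ℕ) :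
    Tendsto (fun y : ℝ => (y : ℂ) ^ m * h (y ^ 2 * u)) atTop (𝓝 0) := by
  obtain ⟨C, hC⟩ := exists_bound_pow_mul h hu m 1
  refine squeeze_zero_norm (hC u le_rfl) ?_
  rw [← mul_zero C]
  refine Tendsto.const_mul C (tendsto_inv_atTop_zero.comp ?_)
  simp only [pow_one]
  exact tendsto_atTop_add_const_left _ _ (tendsto_pow_atTop two_ne_zero)

/-- The derivative of `y^{m+1} h(y²u)` has integral zero over `(0, ∞)`, because the function
vanishes at both ends. -/
lemma integral_Ioi_parts (h : 𝓢(ℝ, ℂ)) {u : ℝ} (hu : 0 < u) (m : ℕ) :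
    2 * u * ∫ y in Ioi (0 : ℝ), (y : ℂ) ^ (m + 2) * iterDeriv 1 h (y ^ 2 * u) =
      -(m + 1) * ∫ y in Ioi (0 : ℝ), (y : ℂ) ^ m * h (y ^ 2 * u) := by
  have hd : ∀ y : ℝ, HasDerivAt (fun y : ℝ => (y : ℂ) ^ (m + 1) * h (y ^ 2 * u))
      ((m + 1) * ((y : ℂ) ^ m * h (y ^ 2 * u)) +
        2 * u * ((y : ℂ) ^ (m + 2) * iterDeriv 1 h (y ^ 2 * u))) y := fun y => by
    have h1 : HasDerivAt (fun y : ℝ => y ^ 2 * u) (2 * y * u) y := by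
      simpa using (hasDerivAt_pow 2 y).mul_const u
    have h2 := (hasDerivAt_iterDeriv 0 h (y ^ 2 * u)).scomp y h1
    have h3 := (hasDerivAt_pow (m + 1) (y : ℂ)).comp_ofReal
    refine (h3.mul h2).congr_deriv ?_
    simp only [iterDeriv_zero, Complex.real_smul, Nat.add_sub_cancel, Function.comp_apply]
    push_cast
    ring
  have hi1 := ((integrable_pow_mul_sq h hu m).const_mul ((m : ℂ) + 1)).integrableOn (s := Ioi 0)
  have hi2 := ((integrable_pow_mul_sq (iterDeriv 1 h) hu (m + 2)).const_mul
    (2 * (u : ℂ))).integrableOn (s := Ioi 0)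
  have h4 := integral_Ioi_of_hasDerivAt_of_tendsto' (a := 0) (fun y _ => hd y) (hi1.add hi2)
    (tendsto_pow_mul_sq h hu (m + 1))
  rw [integral_add hi1 hi2, integral_const_mul, integral_const_mul] at h4
  simp only [Complex.ofReal_zero, ne_eq, Nat.add_eq_zero_iff, one_ne_zero, and_false,
    not_false_eq_true, zero_pow, zero_mul, sub_zero] at h4
  linear_combination h4

/-! ### Radial integrals over a finite-dimensional space -/

variable {E : Type*} [NormedAddCommGroup E] [NormedSpace ℝ E] [FiniteDimensional ℝ E]
  [MeasurableSpace E] [BorelSpace E] {μ : Measure E} [μ.IsAddHaarMeasure]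

lemma integrable_inv_one_add_norm_sq_pow {k : ℕ} (hk : Module.finrank ℝ E < 2 * k) :
    Integrable (fun s : E => ((1 + ‖s‖ ^ 2) ^ k)⁻¹) μ := by
  have h : (Module.finrank ℝ E : ℝ) < 2 * k := by exact_mod_cast hk
  refine (integrable_rpow_neg_one_add_norm_sq (μ := μ) h).congr (Eventually.of_forall fun s => ?_)
  simp only
  rw [show -(2 * (k : ℝ)) / 2 = -k by ring, Real.rpow_neg (by positivity), Real.rpow_natCast]

lemma integrable_norm_pow_mul (h : 𝓢(ℝ, ℂ)) {u : ℝ} (hu : 0 < u) (m : ℕ) :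
    Integrable (fun s : E => (‖s‖ : ℂ) ^ m * h (‖s‖ ^ 2 * u)) μ := by
  obtain ⟨C, hC⟩ := exists_bound_pow_mul h hu m (Module.finrank ℝ E + 1)
  have hc := h.continuous
  exact Integrable.mono' ((integrable_inv_one_add_norm_sq_pow (by lia)).const_mul C)
    (Continuous.aestronglyMeasurable (by fun_prop)) (Eventually.of_forall fun s => hC u le_rfl ‖s‖)

/-- In polar coordinates the power of the radius is `d - 1 + 2p`, so one integration by parts yields
`-(d + 2p)/2`. -/
lemma integral_norm_pow_mul_deriv [Nontrivial E] (h : 𝓢(ℝ, ℂ)) {u : ℝ} (hu : 0 < u) (p : ℕ) :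
    u * ∫ s : E, (‖s‖ : ℂ) ^ (2 * (p + 1)) * iterDeriv 1 h (‖s‖ ^ 2 * u) ∂μ =
      (-(Module.finrank ℝ E : ℂ) / 2 - p) *
        ∫ s : E, (‖s‖ : ℂ) ^ (2 * p) * h (‖s‖ ^ 2 * u) ∂μ := by
  have hd : 0 < Module.finrank ℝ E := Module.finrank_pos
  rw [integral_fun_norm_addHaar μ (fun y => (y : ℂ) ^ (2 * (p + 1)) * iterDeriv 1 h (y ^ 2 * u)),
    integral_fun_norm_addHaar μ (fun y => (y : ℂ) ^ (2 * p) * h (y ^ 2 * u))]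
  have h1 := integral_Ioi_parts h hu (Module.finrank ℝ E - 1 + 2 * p)
  have h2 : ((Module.finrank ℝ E - 1 + 2 * p : ℕ) : ℂ) = Module.finrank ℝ E - 1 + 2 * p := by
    push_cast [Nat.cast_sub hd]
    ring
  simp only [h2, pow_add] at h1
  simp only [Complex.real_smul, nsmul_eq_mul, Complex.ofReal_pow, ← mul_assoc, ← pow_add, mul_add]
    at h1 ⊢
  linear_combination (Module.finrank ℝ E : ℂ) * (μ.real (Metric.ball 0 1) : ℂ) * h1 / 2

lemma integral_comp_norm_sq_mul (h : ℝ → ℂ) {u : ℝ} (hu : 0 < u) :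
    ∫ s : E, h (‖s‖ ^ 2 * u) ∂μ =
      ((u ^ (-(Module.finrank ℝ E : ℝ) / 2) : ℝ) : ℂ) * ∫ s : E, h (‖s‖ ^ 2) ∂μ := by
  have h1 := Measure.integral_comp_smul μ (fun s : E => h (‖s‖ ^ 2)) (√u)
  have h2 : ∀ s : E, ‖√u • s‖ ^ 2 = ‖s‖ ^ 2 * u := fun s => by
    rw [norm_smul, mul_pow, Real.norm_of_nonneg (Real.sqrt_nonneg u), Real.sq_sqrt hu.le, mul_comm]
  simp only [h2] at h1
  rw [h1, Complex.real_smul, abs_of_nonneg (by positivity), Real.sqrt_eq_rpow,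
    ← Real.rpow_mul_natCast hu.le, ← Real.rpow_neg hu.le]
  congr 4
  ring

/-- The scalar identity behind the theorem. Scaling by `√u` gives `p = 0`, and each integration by
parts contributes one factor and one power of `u⁻¹`. -/
lemma integral_norm_pow_mul_iterDeriv [Nontrivial E] (h : 𝓢(ℝ, ℂ)) {u : ℝ} (hu : 0 < u) (p : ℕ) :
    ∫ s : E, (‖s‖ : ℂ) ^ (2 * p) * iterDeriv p h (‖s‖ ^ 2 * u) ∂μ =
      (∏ i ∈ Finset.range p, (-(Module.finrank ℝ E : ℂ) / 2 - i)) *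
        ((u ^ (-(Module.finrank ℝ E : ℝ) / 2 - p) : ℝ) : ℂ) * ∫ s : E, h (‖s‖ ^ 2) ∂μ := by
  induction p with
  | zero =>
    have h1 := integral_comp_norm_sq_mul (μ := μ) h hu
    simpa [iterDeriv_zero] using h1
  | succ p ih =>
    have h1 := integral_norm_pow_mul_deriv (μ := μ) (iterDeriv p h) hu p
    rw [iterDeriv_iterDeriv, ih, add_comm 1 p] at h1
    have hu' : (u : ℂ) ≠ 0 := by exact_mod_cast hu.ne'
    refine mul_left_cancel₀ hu' (h1.trans ?_)
    have h2 : u ^ (-(Module.finrank ℝ E : ℝ) / 2 - p) =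
        u * u ^ (-(Module.finrank ℝ E : ℝ) / 2 - (p + 1 : ℕ)) := by
      rw [mul_comm, ← Real.rpow_add_one hu.ne']
      congr 1
      push_cast
      ring
    rw [h2, Finset.prod_range_succ]
    push_cast
    ring

end MOI

namespace MOI

/-! ### Cutoffs and primitives -/

section Cutoff

open scoped ContDiff

/-- A smooth function on `(0, ∞)` agrees near a compact interval with a Schwartz function. -/
lemma exists_schwartz_eqOn {g : ℝ → ℂ} (hg : ContDiffOn ℝ ∞ g (Ioi 0)) {m M : ℝ} (hm : 0 < m)
    (hmM : m ≤ M) : ∃ (G : 𝓢(ℝ, ℂ)) (U : Set ℝ), IsOpen U ∧ Icc m M ⊆ U ∧ U ⊆ Ioi 0 ∧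
      EqOn g G U := by
  -- The radii make `χ` equal to 1 on `(3m/4, M + m/4)` and supported in `[m/2, M + m/2]`, away from
  -- the singularity at 0.
  let χ : ContDiffBump ((m + M) / 2) :=
    ⟨(M - m) / 2 + m / 4, (M - m) / 2 + m / 2, by linarith, by linarith⟩
  have hsupp : HasCompactSupport fun u => (χ u : ℂ) * g u :=
    HasCompactSupport.mul_right (χ.hasCompactSupport.comp_left Complex.ofReal_zero)
  have hsmooth : ContDiff ℝ ∞ fun u => (χ u : ℂ) * g u := by
    rw [contDiff_iff_contDiffAt]
    intro u
    by_cases hu : 0 < u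
    · exact (Complex.ofRealCLM.contDiff.comp χ.contDiff).contDiffAt.mul
        (hg.contDiffAt (Ioi_mem_nhds hu))
    · have h1 : ∀ᶠ v in 𝓝 u, (χ v : ℂ) * g v = 0 := by
        filter_upwards [Iio_mem_nhds (show u < m / 2 by linarith)] with v hv
        rw [χ.zero_of_le_dist, Complex.ofReal_zero, zero_mul]
        rw [Real.dist_eq, abs_of_neg (by linarith [mem_Iio.mp hv])]
        change (M - m) / 2 + m / 2 ≤ _
        linarith [mem_Iio.mp hv]
      exact (contDiffAt_const (c := (0 : ℂ))).congr_of_eventuallyEq h1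
  refine ⟨hsupp.toSchwartzMap hsmooth, Ioo (3 * m / 4) (M + m / 4), isOpen_Ioo,
    fun u hu => ⟨by linarith [hu.1], by linarith [hu.2]⟩,
    fun u hu => (show (0 : ℝ) < u by linarith [hu.1]), fun u hu => ?_⟩
  have h1 : χ u = 1 := by
    refine χ.one_of_mem_closedBall ?_
    rw [Metric.mem_closedBall, Real.dist_eq]
    change _ ≤ (M - m) / 2 + m / 4
    rw [abs_le]
    constructor <;> linarith [hu.1, hu.2]
  simp [h1]

lemma contDiffOn_rpow_Ioi (a : ℝ) :
    ContDiffOn ℝ ∞ (fun α : ℝ => ((α ^ a : ℝ) : ℂ)) (Ioi 0) := fun α hα =>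
  (Complex.ofRealCLM.contDiff.contDiffAt.comp α
    (contDiffAt_id.rpow_const_of_ne (ne_of_gt hα))).contDiffWithinAt

lemma IsPrimitiveOn.contDiffOn {g : ℝ → ℂ} (hg : ContDiffOn ℝ ∞ g (Ioi 0)) {m : ℕ} {F : ℝ → ℂ}
    (hF : IsPrimitiveOn (Ioi 0) g m F) : ContDiffOn ℝ ∞ F (Ioi 0) := by
  induction m generalizing F with
  | zero => exact hg.congr hF
  | succ m ih =>
    obtain ⟨G, hG, hFG⟩ := hF
    rw [contDiffOn_infty_iff_deriv_of_isOpen isOpen_Ioi]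
    exact ⟨fun α hα => (hFG α hα).differentiableAt.differentiableWithinAt,
      (ih hG).congr fun α hα => (hFG α hα).deriv⟩

lemma IsPrimitiveOn.iteratedDeriv_eq {g : ℝ → ℂ} {m : ℕ} {F : ℝ → ℂ}
    (hF : IsPrimitiveOn (Ioi 0) g m F) : EqOn (iteratedDeriv m F) g (Ioi 0) := by
  induction m generalizing F with
  | zero => simpa using! hF
  | succ m ih =>
    obtain ⟨G, hG, hFG⟩ := hF
    intro α hα
    rw [iteratedDeriv_succ', ← ih hG hα]
    refine Filter.EventuallyEq.iteratedDeriv_eq m ?_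
    filter_upwards [Ioi_mem_nhds hα] with β hβ
    exact (hFG β hβ).deriv

lemma iteratedDeriv_rpow_Ioi (a : ℝ) (p : ℕ) :
    EqOn (iteratedDeriv p fun α : ℝ => ((α ^ a : ℝ) : ℂ))
      (fun α => (∏ i ∈ Finset.range p, ((a : ℂ) - i)) * ((α ^ (a - p) : ℝ) : ℂ)) (Ioi 0) := by
  induction p with
  | zero => intro α _; simp
  | succ p ih =>
    intro α hα
    have h1 : iteratedDeriv p (fun α : ℝ => ((α ^ a : ℝ) : ℂ)) =ᶠ[𝓝 α]
        fun α => (∏ i ∈ Finset.range p, ((a : ℂ) - i)) * ((α ^ (a - p) : ℝ) : ℂ) := by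
      filter_upwards [Ioi_mem_nhds hα] with β hβ using ih hβ
    rw [iteratedDeriv_succ, h1.deriv_eq]
    have h2 : HasDerivAt (fun α : ℝ => ((α ^ (a - p) : ℝ) : ℂ))
        (((a - p) * α ^ (a - p - 1) : ℝ) : ℂ) α :=
      (Real.hasDerivAt_rpow_const (Or.inl (ne_of_gt hα))).ofReal_comp
    rw [(h2.const_mul _).deriv, Finset.prod_range_succ]
    push_cast
    rw [show a - (p + 1 : ℝ) = a - p - 1 by ring]
    ring

/-- Once `m` derivatives are taken the constants of integration are gone. With order `k/2` and `n ≥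
k/2`, the choice of primitive therefore does not affect `F^{(n)}`. -/
lemma IsPrimitiveOn.iteratedDeriv_add_eq {a : ℝ} {m : ℕ} {F : ℝ → ℂ}
    (hF : IsPrimitiveOn (Ioi 0) (fun α => ((α ^ a : ℝ) : ℂ)) m F) (p : ℕ) {α : ℝ} (hα : 0 < α) :
    iteratedDeriv (p + m) F α =
      (∏ i ∈ Finset.range p, ((a : ℂ) - i)) * ((α ^ (a - p) : ℝ) : ℂ) := by
  have h : iteratedDeriv (p + m) F = iteratedDeriv p (iteratedDeriv m F) := by
    simp only [iteratedDeriv_eq_iterate, Function.iterate_add_apply]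
  rw [h]
  refine Eq.trans ?_ (iteratedDeriv_rpow_Ioi a p hα)
  refine Filter.EventuallyEq.iteratedDeriv_eq p ?_
  filter_upwards [Ioi_mem_nhds hα] with β hβ using hF.iteratedDeriv_eq hβ

end Cutoff

/-! ### Fourier representations with respect to a finite measure -/

/-- The finite measure `(1 + ξ²)⁻¹ dξ` on the line. -/
noncomputable def cauchyMeasure : Measure ℝ :=
  volume.withDensity fun ξ => ((Real.toNNReal (1 + ξ ^ 2)⁻¹ : NNReal) : ENNReal)

instance : IsFiniteMeasure cauchyMeasure :=
  isFiniteMeasure_withDensity_ofReal integrable_inv_one_add_sq.2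

lemma integral_cauchyMeasure (g : ℝ → ℂ) :
    ∫ ξ, g ξ ∂cauchyMeasure = ∫ ξ : ℝ, ((1 + ξ ^ 2 : ℝ) : ℂ)⁻¹ * g ξ := by
  rw [cauchyMeasure, integral_withDensity_eq_integral_smul (by fun_prop)]
  refine integral_congr_ae (Eventually.of_forall fun ξ => ?_)
  simp only
  rw [NNReal.smul_def, Real.coe_toNNReal _ (by positivity), Complex.real_smul, Complex.ofReal_inv]

-- Multiple operator integrals ask for a finite measure and bounded integrands; the transform decays
-- fast enough to absorb the factor `1 + ξ²`.
open FourierTransform in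
lemma exists_fourier_rep (g : 𝓢(ℝ, ℂ)) : ∃ ψ : ℝ → ℂ, Measurable ψ ∧ (∃ C, ∀ ξ, ‖ψ ξ‖ ≤ C) ∧
    ∀ u : ℝ, g u = ∫ ξ, ψ ξ * Complex.exp ((2 * Real.pi * ξ * u : ℝ) * Complex.I)
      ∂cauchyMeasure := by
  have hc := (𝓕 g).continuous
  refine ⟨fun ξ => ((1 + ξ ^ 2 : ℝ) : ℂ) * 𝓕 g ξ, Continuous.measurable (by fun_prop), ?_,
    fun u => ?_⟩
  · obtain ⟨C0, -, h0⟩ := (𝓕 g).decay 0 0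
    obtain ⟨C2, -, h2⟩ := (𝓕 g).decay 2 0
    refine ⟨C0 + C2, fun ξ => ?_⟩
    have h0 := h0 ξ
    have h2 := h2 ξ
    rw [norm_iteratedFDeriv_zero, Real.norm_eq_abs] at h0 h2
    rw [sq_abs] at h2
    rw [norm_mul, Complex.norm_real, Real.norm_of_nonneg (by positivity), add_mul]
    linarith
  · rw [eq_integral_fourier, integral_cauchyMeasure]
    refine integral_congr_ae (Eventually.of_forall fun ξ => ?_)
    have h : ((1 + ξ ^ 2 : ℝ) : ℂ) ≠ 0 := Complex.ofReal_ne_zero.mpr (by positivity)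
    simp only
    rw [mul_assoc (((1 + ξ ^ 2 : ℝ)) : ℂ), inv_mul_cancel_left₀ h]
    congr 2
    push_cast
    ring

/-- The frequency `2π(ξ + cη)`. -/
noncomputable def freq (c : ℝ) (ζ : ℝ × ℝ) : ℝ := 2 * Real.pi * (ζ.1 + c * ζ.2)

/-- Write `c^N h(cu) = u^{-N} · (cu)^N h(cu)`. Near `[m, M]` the first factor is a Schwartz function
of `u`, the second is a Schwartz function of `cu`; multiplying their Fourier representations gives
frequencies `ξ + cη` and a coefficient independent of `c`. -/
lemma exists_dilation_rep_aux (h : 𝓢(ℝ, ℂ)) {m M : ℝ} (hm : 0 < m) (hmM : m ≤ M) (N : ℕ) :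
    ∃ ψ : ℝ × ℝ → ℂ, Measurable ψ ∧ (∃ C, ∀ ζ, ‖ψ ζ‖ ≤ C) ∧
      ∀ c u : ℝ, 0 < c → u ∈ Icc m M → (c : ℂ) ^ N * h (c * u) =
        ∫ ζ, ψ ζ * Complex.exp ((freq c ζ * u : ℝ) * Complex.I)
          ∂(cauchyMeasure.prod cauchyMeasure) := by
  have hp : Function.HasTemperateGrowth fun v : ℝ => (v : ℂ) ^ N :=
    Function.HasTemperateGrowth.pow (by fun_prop) N
  obtain ⟨ψ₂, hψ₂, ⟨C₂, hC₂⟩, h₂⟩ := exists_fourier_rep (SchwartzMap.smulLeftCLM ℂ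
    (fun v : ℝ => (v : ℂ) ^ N) h)
  obtain ⟨η, U, -, hU, -, hη⟩ := exists_schwartz_eqOn (contDiffOn_rpow_Ioi (-N)) hm hmM
  obtain ⟨ψ₁, hψ₁, ⟨C₁, hC₁⟩, h₁⟩ := exists_fourier_rep η
  refine ⟨fun ζ => ψ₁ ζ.1 * ψ₂ ζ.2, by fun_prop, ⟨C₁ * C₂, fun ζ => ?_⟩, fun c u hc hu => ?_⟩
  · rw [norm_mul]
    exact mul_le_mul (hC₁ _) (hC₂ _) (norm_nonneg _) ((norm_nonneg _).trans (hC₁ 0))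
  · have hu0 : 0 < u := hm.trans_le hu.1
    have e1 := h₁ u
    rw [← hη (hU hu)] at e1
    simp only at e1
    rw [Real.rpow_neg hu0.le, Real.rpow_natCast] at e1
    have e2 := h₂ (c * u)
    rw [SchwartzMap.smulLeftCLM_apply_apply hp, smul_eq_mul] at e2
    have e3 : (c : ℂ) ^ N * h (c * u) = (((u ^ N)⁻¹ : ℝ) : ℂ) * (((c * u : ℝ) : ℂ) ^ N *
        h (c * u)) := by
      have : (u : ℂ) ≠ 0 := Complex.ofReal_ne_zero.mpr hu0.ne'
      push_cast
      field_simp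
      ring
    rw [e3, e1, e2, ← integral_prod_mul]
    refine integral_congr_ae (Eventually.of_forall fun ζ => ?_)
    simp only
    rw [mul_mul_mul_comm, ← Complex.exp_add]
    congr 2
    rw [freq]
    push_cast
    ring

/-- The dilations `u ↦ h(cu)` are, on a compact subinterval of `(0, ∞)`, superpositions of
exponentials with coefficients that decay rapidly in `c`. -/
lemma exists_dilation_rep (h : 𝓢(ℝ, ℂ)) {m M : ℝ} (hm : 0 < m) (hmM : m ≤ M) (N : ℕ) :
    ∃ Ψ : ℝ × ℝ × ℝ → ℂ, Measurable Ψ ∧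
      (∃ C, ∀ c ζ, 0 ≤ c → (1 + c) ^ N * ‖Ψ (c, ζ)‖ ≤ C) ∧
      ∀ c u : ℝ, 0 < c → u ∈ Icc m M → h (c * u) =
        ∫ ζ, Ψ (c, ζ) * Complex.exp ((freq c ζ * u : ℝ) * Complex.I)
          ∂(cauchyMeasure.prod cauchyMeasure) := by
  obtain ⟨ψ, hψ, ⟨C, hC⟩, e⟩ := exists_dilation_rep_aux h hm hmM 0
  obtain ⟨ψ', hψ', ⟨C', hC'⟩, e'⟩ := exists_dilation_rep_aux h hm hmM N
  -- For `c ≤ 1` the representation without decay suffices; for `c > 1` the one of `c^N h(cu)` is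
  -- divided by `c^N`. In both cases the weight costs at most `2^N`.
  refine ⟨fun p => if p.1 ≤ 1 then ψ p.2 else ((p.1 : ℂ) ^ N)⁻¹ * ψ' p.2,
    Measurable.ite (measurableSet_le measurable_fst measurable_const) (by fun_prop) (by fun_prop),
    ⟨2 ^ N * max C C', fun c ζ hc => ?_⟩, fun c u hc hu => ?_⟩
  · simp only
    split_ifs with h1
    · gcongr
      · linarith
      · exact (hC _).trans (le_max_left _ _)
    · push Not at h1
      rw [norm_mul, norm_inv, norm_pow, Complex.norm_real, Real.norm_of_nonneg hc, ← mul_assoc,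
        ← div_eq_mul_inv, ← div_pow]
      gcongr
      · rw [div_le_iff₀ (by linarith)]; linarith
      · exact (hC' _).trans (le_max_right _ _)
  · simp only
    split_ifs with h1
    · simpa using e c u hc hu
    · have hc' : (c : ℂ) ^ N ≠ 0 := pow_ne_zero _ (Complex.ofReal_ne_zero.mpr hc.ne')
      simp_rw [mul_assoc]
      rw [integral_const_mul, ← e' c u hc hu, inv_mul_cancel_left₀ hc']

/-- The divided difference of a dilated Schwartz function. -/
lemma IsSimplex.divDiff_dilation_eq {n : ℕ} {Ω : Type*} [MeasurableSpace Ω] {ν : Measure Ω}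
    [IsFiniteMeasure ν] {lam : Fin (n + 1) → Ω → ℝ} (h : IsSimplex n ν lam) (f : 𝓢(ℝ, ℂ)) {c : ℝ}
    (hc : c ≠ 0) (α : Fin (n + 1) → ℝ) :
    divDiff (dilation c⁻¹ f) n α =
      ∫ ω, (c : ℂ) ^ n * iterDeriv n f (c * ∑ j, lam j ω * α j) ∂ν := by
  let g : 𝓢(ℝ, ℂ) := SchwartzMap.compCLMOfContinuousLinearEquiv ℂ
    (ContinuousLinearEquiv.smulLeft (Units.mk0 c hc)) f
  have hg : dilation c⁻¹ f = g := by
    funext α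
    simp only [dilation, div_inv_eq_mul]
    change _ = f (c • α)
    rw [smul_eq_mul, mul_comm]
  have hg2 : (g : ℝ → ℂ) = fun u => f (c * u) := by
    rw [← hg]; funext α; simp only [dilation, div_inv_eq_mul]; rw [mul_comm]
  rw [hg, h.divDiff_eq]
  refine integral_congr_ae (Eventually.of_forall fun ω => ?_)
  simp only
  rw [coe_iterDeriv, coe_iterDeriv, hg2, iteratedDeriv_comp_const_smul (f.smooth n)]
  simp

end MOI

namespace MOI

/-! ### The symbols as superpositions of exponentials -/

section Rep

variable {H : Type*} [NormedAddCommGroup H] [InnerProductSpace ℂ H] [CompleteSpace H]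
  {n : ℕ} {Ω : Type} [MeasurableSpace Ω] {ν : Measure Ω} [IsFiniteMeasure ν]
  {lam : Fin (n + 1) → Ω → ℝ} {m M : ℝ}

/-- Convexity keeps the barycentres in `[m, M]`, so one-variable identities known only on that
interval may be used inside simplex averages. -/
lemma IsSimplex.ae_sum_mem_Icc (h : IsSimplex n ν lam) {α : Fin (n + 1) → ℝ}
    (hα : ∀ j, α j ∈ Icc m M) : ∀ᵐ ω ∂ν, ∑ j, lam j ω * α j ∈ Icc m M := by
  filter_upwards [h.ae_nonneg, h.ae_sum] with ω h1 h2
  constructor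
  · calc m = ∑ j, lam j ω * m := by rw [← Finset.sum_mul, h2, one_mul]
      _ ≤ _ := Finset.sum_le_sum fun j _ => mul_le_mul_of_nonneg_left (hα j).1 (h1 j)
  · calc ∑ j, lam j ω * α j ≤ ∑ j, lam j ω * M :=
        Finset.sum_le_sum fun j _ => mul_le_mul_of_nonneg_left (hα j).2 (h1 j)
      _ = M := by rw [← Finset.sum_mul, h2, one_mul]

/-- The finite measure on the parameter space of the exponentials. -/
noncomputable abbrev paramMeasure (ν : Measure Ω) : Measure ((ℝ × ℝ) × Ω) :=
  (cauchyMeasure.prod cauchyMeasure).prod ν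

/-- The frequencies of the exponential factors. -/
noncomputable def paramFreq (lam : Fin (n + 1) → Ω → ℝ) (c : ℝ) (j : Fin (n + 1))
    (p : (ℝ × ℝ) × Ω) : ℝ := freq c p.1 * lam j p.2

lemma IsSimplex.measurable_paramFreq (h : IsSimplex n ν lam) (j : Fin (n + 1)) :
    Measurable fun q : ℝ × (ℝ × ℝ) × Ω => paramFreq lam q.1 j q.2 := by
  have h1 : Measurable fun q : ℝ × (ℝ × ℝ) × Ω => lam j q.2.2 := (h.measurable j).comp (by fun_prop)
  have h2 : Measurable fun q : ℝ × (ℝ × ℝ) × Ω => freq q.1 q.2.1 := by unfold freq; fun_prop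
  exact h2.mul h1

lemma sum_paramFreq_mul (c : ℝ) (p : (ℝ × ℝ) × Ω) (α : Fin (n + 1) → ℝ) :
    ∑ j, paramFreq lam c j p * α j = freq c p.1 * ∑ j, lam j p.2 * α j := by
  simp only [paramFreq, Finset.mul_sum, mul_assoc]

lemma IsSimplex.integral_paramMeasure (h : IsSimplex n ν lam) {ψ : ℝ × ℝ → ℂ} (hψ : Measurable ψ)
    {C : ℝ} (hC : ∀ ζ, ‖ψ ζ‖ ≤ C) {c : ℝ} {g : ℝ → ℂ} (hg : ∀ u ∈ Icc m M, g u =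
      ∫ ζ, ψ ζ * Complex.exp ((freq c ζ * u : ℝ) * Complex.I) ∂(cauchyMeasure.prod cauchyMeasure))
    {α : Fin (n + 1) → ℝ} (hα : ∀ j, α j ∈ Icc m M) :
    ∫ p, ψ p.1 * Complex.exp ((∑ j, paramFreq lam c j p * α j : ℝ) * Complex.I)
        ∂(paramMeasure ν) = ∫ ω, g (∑ j, lam j ω * α j) ∂ν := by
  have hm : Measurable fun p : (ℝ × ℝ) × Ω => ψ p.1 *
      Complex.exp ((∑ j, paramFreq lam c j p * α j : ℝ) * Complex.I) := by
    have h1 : Measurable fun p : (ℝ × ℝ) × Ω => ∑ j, paramFreq lam c j p * α j :=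
      Finset.measurable_fun_sum _ fun j _ =>
        ((h.measurable_paramFreq j).comp (by fun_prop : Measurable fun p => (c, p))).mul_const _
    have h2 : Measurable fun p : (ℝ × ℝ) × Ω => ψ p.1 := hψ.comp measurable_fst
    fun_prop
  have hi : Integrable (fun p : (ℝ × ℝ) × Ω => ψ p.1 *
      Complex.exp ((∑ j, paramFreq lam c j p * α j : ℝ) * Complex.I)) (paramMeasure ν) :=
    Integrable.of_bound hm.aestronglyMeasurable C (Eventually.of_forall fun p => by
      rw [norm_mul, Complex.norm_exp_ofReal_mul_I, mul_one]; exact hC _)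
  rw [integral_prod_symm _ hi]
  refine integral_congr_ae ?_
  filter_upwards [h.ae_sum_mem_Icc hα] with ω hω
  simp only [sum_paramFreq_mul]
  exact (hg _ hω).symm

/-- A symbol which is an average of a superposition of exponentials over the simplex defines a
multiple operator integral. -/
lemma IsSimplex.isMultOpInt (h : IsSimplex n ν lam) {x : H →L[ℂ] H} (hx : IsSelfAdjoint x)
    (hspec : spectrum ℝ x ⊆ Icc m M) {ψ : ℝ × ℝ → ℂ} (hψ : Measurable ψ)
    {C : ℝ} (hC : ∀ ζ, ‖ψ ζ‖ ≤ C) {c : ℝ} {g : ℝ → ℂ} (hg : ∀ u ∈ Icc m M, g u =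
      ∫ ζ, ψ ζ * Complex.exp ((freq c ζ * u : ℝ) * Complex.I) ∂(cauchyMeasure.prod cauchyMeasure))
    {φ : (Fin (n + 1) → ℝ) → ℂ} (hφ : ∀ α : Fin (n + 1) → ℝ, (∀ j, α j ∈ Icc m M) →
      φ α = ∫ ω, g (∑ j, lam j ω * α j) ∂ν) :
    IsMultOpInt x φ fun V => ∫ p, ψ p.1 • expProd x V (fun j => paramFreq lam c j p)
      ∂(paramMeasure ν) := by
  refine isMultOpInt_expProd hx (hψ.comp measurable_fst) (fun p => hC p.1)
    (fun j => (h.measurable_paramFreq j).comp (by fun_prop : Measurable fun p => (c, p)))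
    (fun α hα => ?_)
  have hα' := fun j => hspec (hα j)
  rw [hφ α hα', ← h.integral_paramMeasure hψ hC hg hα']
  rfl

end Rep

/-! ### Values in the von Neumann algebra -/

section Values

variable {d : ℕ} {θ : Matrix (Fin d) (Fin d) ℝ}

lemma isClosed_Linfty (θ : Matrix (Fin d) (Fin d) ℝ) :
    IsClosed ((Linfty θ : StarSubalgebra ℂ (L2 d →L[ℂ] L2 d)) : Set (L2 d →L[ℂ] L2 d)) :=
  (StarSubalgebra.isClosed_topologicalClosure _).preimage
    ContinuousLinearMapWOT.continuous_ofCLM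

lemma expI_mem_Linfty {x : L2 d →L[ℂ] L2 d} (hx : x ∈ Linfty θ) (y : ℝ) :
    expI x y ∈ Linfty θ := by
  let +nondep : NormedAlgebra ℚ (L2 d →L[ℂ] L2 d) := NormedAlgebra.restrictScalars ℚ ℂ _
  exact NormedSpace.exp_mem (R := ℂ) (isClosed_Linfty θ) ((Linfty θ).smul_mem hx _)

lemma altProd_mem_Linfty {n : ℕ} {A : Fin (n + 1) → L2 d →L[ℂ] L2 d}
    {V : Fin n → L2 d →L[ℂ] L2 d} (hA : ∀ j, A j ∈ Linfty θ) (hV : ∀ j, V j ∈ Linfty θ) :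
    altProd A V ∈ Linfty θ := by
  induction n with
  | zero => rw [altProd_zero]; exact hA 0
  | succ n ih =>
    rw [altProd_succ]
    exact mul_mem (hA 0) (mul_mem (hV 0) (ih (fun j => hA _) (fun j => hV _)))

/-- The product `e^{i y_0 x} b_1 e^{i y_1 x} ⋯ b_n e^{i y_n x}` in `L_∞`. -/
noncomputable def expProdL (x : Linfty θ) {n : ℕ} (b : Fin n → Linfty θ) (y : Fin (n + 1) → ℝ) :
    Linfty θ :=
  ⟨expProd (x : L2 d →L[ℂ] L2 d) (fun j => (b j : L2 d →L[ℂ] L2 d)) y,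
    altProd_mem_Linfty (fun _ => expI_mem_Linfty x.2 _) fun j => (b j).2⟩

lemma continuous_expProdL (x : Linfty θ) {n : ℕ} (b : Fin n → Linfty θ) :
    Continuous (expProdL x b) :=
  (continuous_expProd _ _).subtype_mk _

lemma norm_expProdL_le {x : Linfty θ} (hx : IsSelfAdjoint (x : L2 d →L[ℂ] L2 d)) {n : ℕ}
    (b : Fin n → Linfty θ) (y : Fin (n + 1) → ℝ) :
    ‖expProdL x b y‖ ≤ 4 ^ (n + 1) * ∏ j, ‖b j‖ :=
  norm_expProd_le hx _ y

/-- The inclusion of `L_∞` into the bounded operators, as a continuous linear map. -/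
noncomputable def LinftySubtype (θ : Matrix (Fin d) (Fin d) ℝ) :
    Linfty θ →L[ℂ] (L2 d →L[ℂ] L2 d) :=
  ⟨(Linfty θ).subtype.toAlgHom.toLinearMap, continuous_subtype_val⟩

lemma coe_integral_Linfty {P : Type*} [MeasurableSpace P] {π : Measure P} {g : P → Linfty θ}
    (hg : Integrable g π) :
    ((∫ p, g p ∂π : Linfty θ) : L2 d →L[ℂ] L2 d) = ∫ p, (g p : L2 d →L[ℂ] L2 d) ∂π :=
  ((LinftySubtype θ).integral_comp_comm hg).symm

end Values

lemma exists_spectrum_subset_Icc {H : Type*} [NormedAddCommGroup H] [InnerProductSpace ℂ H]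
    [CompleteSpace H] {x : H →L[ℂ] H} (hx : x.IsPositive) (hu : IsUnit x) :
    ∃ m M : ℝ, 0 < m ∧ m ≤ M ∧ spectrum ℝ x ⊆ Icc m M := by
  have h0 : ∀ t ∈ spectrum ℝ x, 0 < t := fun t ht => by
    have h1 : 0 ≤ t := spectrum_nonneg_of_nonneg
      ((ContinuousLinearMap.nonneg_iff_isPositive x).mpr hx) ht
    refine lt_of_le_of_ne h1 fun h => ?_
    rw [← h] at ht
    exact spectrum.zero_notMem ℝ hu ht
  have hc : IsCompact (spectrum ℝ x) := spectrum.isCompact x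
  rcases (spectrum ℝ x).eq_empty_or_nonempty with he | hne
  -- With empty spectrum (the zero space) any positive bounds serve.
  · exact ⟨1, 1, one_pos, le_rfl, by simp [he]⟩
  · obtain ⟨m, hm, hm'⟩ := hc.exists_isLeast hne
    obtain ⟨M, hM, hM'⟩ := hc.exists_isGreatest hne
    exact ⟨m, M, h0 m hm, hm' hM, fun t ht => ⟨hm' ht, hM' ht⟩⟩

/-- The orthonormal basis `U^n` of `L₂(𝕋^d_θ)`. -/
noncomputable def L2Basis (d : ℕ) : HilbertBasis (Fin d → ℤ) ℂ (L2 d) :=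
  HilbertBasis.ofRepr (LinearIsometryEquiv.refl ℂ (L2 d))

end MOI

namespace MOI

/-! ### The integral formula -/

section Decay

variable {E : Type*} [NormedAddCommGroup E] [NormedSpace ℝ E] [FiniteDimensional ℝ E]
  [MeasurableSpace E] [BorelSpace E]

/-- The density `(1 + |s|²)^{-(d+1)}` on a `d`-dimensional space. -/
noncomputable def decay (s : E) : ℝ := ((1 + ‖s‖ ^ 2) ^ (Module.finrank ℝ E + 1))⁻¹

lemma decay_pos (s : E) : 0 < decay s := by unfold decay; positivity

lemma continuous_decay : Continuous (decay : E → ℝ) := by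
  unfold decay
  refine Continuous.inv₀ (by fun_prop) fun s => by positivity

lemma integrable_decay (μ : Measure E) [μ.IsAddHaarMeasure] : Integrable (decay : E → ℝ) μ :=
  integrable_inv_one_add_norm_sq_pow (by lia)

/-- The finite measure with density `decay`. -/
noncomputable def decayMeasure (μ : Measure E) : Measure E :=
  μ.withDensity fun s => ((Real.toNNReal (decay s) : NNReal) : ENNReal)

instance (μ : Measure E) [μ.IsAddHaarMeasure] : IsFiniteMeasure (decayMeasure μ) :=
  isFiniteMeasure_withDensity_ofReal (integrable_decay μ).2

lemma integral_decayMeasure {F : Type*} [NormedAddCommGroup F] [NormedSpace ℂ F]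
    (μ : Measure E) (g : E → F) :
    ∫ s, ((decay s : ℂ)⁻¹) • g s ∂(decayMeasure μ) = ∫ s, g s ∂μ := by
  rw [decayMeasure, integral_withDensity_eq_integral_smul
    (by have := (continuous_decay (E := E)).measurable; fun_prop)]
  refine integral_congr_ae (Eventually.of_forall fun s => ?_)
  simp only
  rw [NNReal.smul_def, Real.coe_toNNReal _ (decay_pos s).le, ← Complex.coe_smul, smul_smul,
    mul_inv_cancel₀ (Complex.ofReal_ne_zero.mpr (decay_pos s).ne'), one_smul]

/-- Of the exponent `p + (d + 1)`, the first `p` powers compensate `|s|^{2p}` and the other `d + 1`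
compensate the reciprocal of `decay`. -/
lemma norm_inv_decay_mul_le {Ψ : ℝ × ℝ × ℝ → ℂ} {p : ℕ} {C : ℝ}
    (hC : ∀ c ζ, 0 ≤ c → (1 + c) ^ (p + (Module.finrank ℝ E + 1)) * ‖Ψ (c, ζ)‖ ≤ C) (s : E)
    (ζ : ℝ × ℝ) :
    ‖(decay s : ℂ)⁻¹ * ((‖s‖ : ℂ) ^ (2 * p) * Ψ (‖s‖ ^ 2, ζ))‖ ≤ C := by
  refine le_trans ?_ (hC (‖s‖ ^ 2) ζ (by positivity))
  rw [norm_mul, norm_mul, norm_inv, norm_pow, Complex.norm_real, Complex.norm_real, norm_norm,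
    Real.norm_of_nonneg (decay_pos s).le, decay, inv_inv, pow_mul, pow_add (1 + ‖s‖ ^ 2) p,
    ← mul_assoc, mul_comm ((1 + ‖s‖ ^ 2) ^ p)]
  gcongr
  linarith

end Decay

section Symbol

variable {n : ℕ} {Ω : Type} [MeasurableSpace Ω] {ν : Measure Ω} [IsFiniteMeasure ν]
  {lam : Fin (n + 1) → Ω → ℝ} {m M : ℝ} {E : Type} [NormedAddCommGroup E] [NormedSpace ℝ E]
  [FiniteDimensional ℝ E] [MeasurableSpace E] [BorelSpace E] {μ : Measure E} [μ.IsAddHaarMeasure]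

/-- The scalar version of the integral formula. -/
lemma IsSimplex.integral_integral_norm_pow [Nontrivial E] (h : IsSimplex n ν lam) (hm : 0 < m)
    (g : 𝓢(ℝ, ℂ)) (p : ℕ) {G : 𝓢(ℝ, ℂ)} (hG : ∀ u ∈ Icc m M, G u =
      (∏ i ∈ Finset.range p, (-(Module.finrank ℝ E : ℂ) / 2 - i)) *
        ((u ^ (-(Module.finrank ℝ E : ℝ) / 2 - p) : ℝ) : ℂ))
    {α : Fin (n + 1) → ℝ} (hα : ∀ j, α j ∈ Icc m M) :
    ∫ s : E, (‖s‖ : ℂ) ^ (2 * p) * ∫ ω, iterDeriv p g (‖s‖ ^ 2 * ∑ j, lam j ω * α j) ∂ν ∂μ =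
      (∫ s : E, g (‖s‖ ^ 2) ∂μ) * ∫ ω, G (∑ j, lam j ω * α j) ∂ν := by
  simp_rw [← integral_const_mul]
  have hmem := h.ae_sum_mem_Icc hα
  rw [integral_integral_swap]
  · refine integral_congr_ae ?_
    filter_upwards [hmem] with ω hω
    rw [integral_norm_pow_mul_iterDeriv g (hm.trans_le hω.1), hG _ hω]
    ring
  · obtain ⟨C, hC⟩ := exists_bound_pow_mul (iterDeriv p g) hm (2 * p) (Module.finrank ℝ E + 1)
    refine Integrable.mono' (((integrable_decay μ).const_mul C).comp_fst ν) ?_ ?_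
    · have h1 : Measurable fun q : E × Ω => ∑ j, lam j q.2 * α j :=
        (h.measurable_sum α).comp measurable_snd
      have h2 := (iterDeriv p g).continuous.measurable
      exact Measurable.aestronglyMeasurable (by fun_prop)
    · filter_upwards [Measure.quasiMeasurePreserving_snd.ae hmem] with q hq
      exact hC _ hq.1 ‖q.1‖

variable {H : Type*} [NormedAddCommGroup H] [InnerProductSpace ℂ H] [CompleteSpace H]

/-- The integral over `s` of the multiple operator integrals is itself a multiple operator
integral. -/
lemma IsSimplex.isMultOpInt_integral [Nontrivial E] (h : IsSimplex n ν lam) {x : H →L[ℂ] H}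
    (hx : IsSelfAdjoint x) (hm : 0 < m) (hspec : spectrum ℝ x ⊆ Icc m M) {Ψ : ℝ × ℝ × ℝ → ℂ}
    (hΨ : Measurable Ψ) (g : 𝓢(ℝ, ℂ)) (p : ℕ) {C : ℝ}
    (hC : ∀ c ζ, 0 ≤ c → (1 + c) ^ (p + (Module.finrank ℝ E + 1)) * ‖Ψ (c, ζ)‖ ≤ C)
    (hrep : ∀ c u : ℝ, 0 < c → u ∈ Icc m M → iterDeriv p g (c * u) =
        ∫ ζ, Ψ (c, ζ) * Complex.exp ((freq c ζ * u : ℝ) * Complex.I)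
          ∂(cauchyMeasure.prod cauchyMeasure)) {G : 𝓢(ℝ, ℂ)} (hG : ∀ u ∈ Icc m M, G u =
      (∏ i ∈ Finset.range p, (-(Module.finrank ℝ E : ℂ) / 2 - i)) *
        ((u ^ (-(Module.finrank ℝ E : ℝ) / 2 - p) : ℝ) : ℂ))
    {φ : (Fin (n + 1) → ℝ) → ℂ} (hφ : ∀ α : Fin (n + 1) → ℝ, (∀ j, α j ∈ Icc m M) →
      φ α = (∫ s : E, g (‖s‖ ^ 2) ∂μ) * ∫ ω, G (∑ j, lam j ω * α j) ∂ν) :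
    IsMultOpInt x φ fun V => ∫ s : E, ((‖s‖ : ℂ) ^ (2 * p)) • ∫ q, Ψ (‖s‖ ^ 2, q.1) •
      expProd x V (fun j => paramFreq lam (‖s‖ ^ 2) j q) ∂(paramMeasure ν) ∂μ := by
  have hdm : Measurable (decay : E → ℝ) := continuous_decay.measurable
  have hq : Measurable fun r : E × (ℝ × ℝ) × Ω =>
      (decay r.1 : ℂ)⁻¹ * ((‖r.1‖ : ℂ) ^ (2 * p) * Ψ (‖r.1‖ ^ 2, r.2.1)) := by
    have h1 : Measurable fun r : E × (ℝ × ℝ) × Ω => Ψ (‖r.1‖ ^ 2, r.2.1) :=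
      hΨ.comp (by fun_prop)
    have h2 : Measurable fun r : E × (ℝ × ℝ) × Ω => decay r.1 := hdm.comp measurable_fst
    fun_prop
  have hqC : ∀ r : E × (ℝ × ℝ) × Ω,
      ‖(decay r.1 : ℂ)⁻¹ * ((‖r.1‖ : ℂ) ^ (2 * p) * Ψ (‖r.1‖ ^ 2, r.2.1))‖ ≤ C := fun r =>
    norm_inv_decay_mul_le hC r.1 r.2.1
  have hy : ∀ j, Measurable fun r : E × (ℝ × ℝ) × Ω => paramFreq lam (‖r.1‖ ^ 2) j r.2 := fun j =>
    (h.measurable_paramFreq j).comp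
      (by fun_prop : Measurable fun r : E × (ℝ × ℝ) × Ω => (‖r.1‖ ^ 2, r.2))
  -- Passing the weight `decay` to the measure makes `s` one more parameter in a finite measure
  -- space with bounded coefficients.
  have key := isMultOpInt_expProd (π := (decayMeasure μ).prod (paramMeasure ν)) (φ := φ) hx hq hqC
    hy (fun α hα => ?_)
  · convert key using 2 with V
    rw [integral_prod _ (integrable_smul_expProd hx V hq hqC hy), ← integral_decayMeasure]
    refine integral_congr_ae (Eventually.of_forall fun s => ?_)
    simp only
    simp_rw [← smul_smul, integral_smul]
  · have hα' := fun j => hspec (hα j)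
    have hi : Integrable (fun r : E × (ℝ × ℝ) × Ω =>
        ((decay r.1 : ℂ)⁻¹ * ((‖r.1‖ : ℂ) ^ (2 * p) * Ψ (‖r.1‖ ^ 2, r.2.1))) *
          Complex.exp ((∑ j, paramFreq lam (‖r.1‖ ^ 2) j r.2 * α j : ℝ) * Complex.I))
        ((decayMeasure μ).prod (paramMeasure ν)) := by
      refine Integrable.of_bound (C := C) ?_ (Eventually.of_forall fun r => ?_)
      · have h3 : Measurable fun r : E × (ℝ × ℝ) × Ω =>
            ∑ j, paramFreq lam (‖r.1‖ ^ 2) j r.2 * α j :=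
          Finset.measurable_fun_sum _ fun j _ => (hy j).mul_const _
        exact (hq.mul (by fun_prop)).aestronglyMeasurable
      · rw [norm_mul, Complex.norm_exp_ofReal_mul_I, mul_one]; exact hqC r
    rw [hφ α hα', ← h.integral_integral_norm_pow hm g p hG hα', integral_prod _ hi,
      ← integral_decayMeasure]
    -- The exponential representation is available only for `c = |s|² > 0`, and the origin is a null
    -- set.
    have h0 : ∀ᵐ s : E ∂(decayMeasure μ), s ≠ 0 :=
      (withDensity_absolutelyContinuous _ _).ae_le (Measure.ae_ne μ 0)
    refine integral_congr_ae ?_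
    filter_upwards [h0] with s hs
    simp_rw [mul_assoc, integral_const_mul, smul_eq_mul]
    have hs' : 0 < ‖s‖ ^ 2 := by positivity
    rw [h.integral_paramMeasure (ψ := fun ζ => Ψ (‖s‖ ^ 2, ζ)) (hΨ.comp (by fun_prop)) (C := C)
      (fun ζ => ?_) (fun u hu => hrep _ u hs' hu) hα']
    refine le_trans ?_ (hC (‖s‖ ^ 2) ζ hs'.le)
    exact le_mul_of_one_le_left (norm_nonneg _) (one_le_pow₀ (by linarith))

end Symbol

end MOI

namespace MOI

/-! ### Powers of `|s|` and integrability in `L_∞` -/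

lemma norm_zpow_mul_pow {r : ℝ} (hr : r ≠ 0) (j p : ℕ) :
    r ^ (-((j + j : ℕ) : ℤ)) * (r ^ 2) ^ (p + j) = r ^ (2 * p) := by
  rw [zpow_neg, zpow_natCast, ← pow_mul, show 2 * (p + j) = j + j + 2 * p by ring,
    pow_add r (j + j) (2 * p), inv_mul_cancel_left₀ (pow_ne_zero _ hr)]

/-- With `k = 2j` and `n = p + j`, this combines `|s|^{-k}` with the factor `|s|^{2n}` from the
`n`-th derivative of the dilation. -/
lemma norm_zpow_smul_ae_eq {E F : Type*} [NormedAddCommGroup E] [NormedSpace ℝ E]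
    [FiniteDimensional ℝ E] [Nontrivial E] [MeasurableSpace E] [BorelSpace E] (μ : Measure E)
    [μ.IsAddHaarMeasure] [NormedAddCommGroup F] [NormedSpace ℂ F] (j p : ℕ) (Q : E → F) :
    (fun s : E => (‖s‖ ^ (-((j + j : ℕ) : ℤ)) : ℝ) • (((‖s‖ ^ 2 : ℝ) : ℂ) ^ (p + j) • Q s)) =ᵐ[μ]
      fun s => ((‖s‖ : ℂ) ^ (2 * p)) • Q s := by
  filter_upwards [Measure.ae_ne μ 0] with s hs
  rw [← Complex.coe_smul, smul_smul]
  congr 1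
  rw [← Complex.ofReal_pow, ← Complex.ofReal_mul, norm_zpow_mul_pow (norm_ne_zero_iff.mpr hs),
    Complex.ofReal_pow]

section Linfty

variable {d n : ℕ} {θ : Matrix (Fin d) (Fin d) ℝ} {Ω : Type} [MeasurableSpace Ω] {ν : Measure Ω}
  [IsFiniteMeasure ν] {lam : Fin (n + 1) → Ω → ℝ}

lemma coe_smul_Linfty (c : ℂ) (a : Linfty θ) :
    ((c • a : Linfty θ) : L2 d →L[ℂ] L2 d) = c • (a : L2 d →L[ℂ] L2 d) := rfl

lemma IsSimplex.integrable_smul_expProdL (h : IsSimplex n ν lam) {x : Linfty θ}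
    (hx : IsSelfAdjoint (x : L2 d →L[ℂ] L2 d)) (b : Fin n → Linfty θ) {ψ : ℝ × ℝ → ℂ}
    (hψ : Measurable ψ) {C : ℝ} (hC : ∀ ζ, ‖ψ ζ‖ ≤ C) (c : ℝ) :
    Integrable (fun q => ψ q.1 • expProdL x b (fun j => paramFreq lam c j q)) (paramMeasure ν) := by
  refine Integrable.of_bound (C := C * (4 ^ (n + 1) * ∏ j, ‖b j‖)) ?_
    (Eventually.of_forall fun q => ?_)
  · refine ((hψ.comp measurable_fst).stronglyMeasurable.smul
      ((continuous_expProdL x b).comp_stronglyMeasurable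
        (measurable_pi_lambda _ fun j => ?_).stronglyMeasurable)).aestronglyMeasurable
    exact (h.measurable_paramFreq j).comp (by fun_prop : Measurable fun q => (c, q))
  · rw [norm_smul]
    exact mul_le_mul (hC _) (norm_expProdL_le hx b _) (norm_nonneg _)
      ((norm_nonneg _).trans (hC q.1))

lemma IsSimplex.stronglyMeasurable_expProdL (h : IsSimplex n ν lam) (x : Linfty θ)
    (b : Fin n → Linfty θ) {Ψ : ℝ × ℝ × ℝ → ℂ} (hΨ : Measurable Ψ) :
    StronglyMeasurable fun c : ℝ => ∫ q, Ψ (c, q.1) •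
      expProdL x b (fun j => paramFreq lam c j q) ∂(paramMeasure ν) := by
  refine StronglyMeasurable.integral_prod_right' (f := fun r : ℝ × (ℝ × ℝ) × Ω =>
    Ψ (r.1, r.2.1) • expProdL x b (fun j => paramFreq lam r.1 j r.2)) ?_
  refine StronglyMeasurable.smul (f := fun r : ℝ × (ℝ × ℝ) × Ω => Ψ (r.1, r.2.1))
    (hΨ.comp (by fun_prop)).stronglyMeasurable ?_
  exact (continuous_expProdL x b).comp_stronglyMeasurable
    (measurable_pi_lambda _ fun j => h.measurable_paramFreq j).stronglyMeasurable

lemma IsSimplex.integrable_norm_pow_smul {E : Type*} [NormedAddCommGroup E] [NormedSpace ℝ E]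
    [FiniteDimensional ℝ E] [MeasurableSpace E] [BorelSpace E] (μ : Measure E)
    [μ.IsAddHaarMeasure] (h : IsSimplex n ν lam) {x : Linfty θ}
    (hx : IsSelfAdjoint (x : L2 d →L[ℂ] L2 d)) (b : Fin n → Linfty θ) {Ψ : ℝ × ℝ × ℝ → ℂ}
    (hΨ : Measurable Ψ) {p : ℕ} {C : ℝ}
    (hC : ∀ c ζ, 0 ≤ c → (1 + c) ^ (p + (Module.finrank ℝ E + 1)) * ‖Ψ (c, ζ)‖ ≤ C) :
    Integrable (fun s : E => ((‖s‖ : ℂ) ^ (2 * p)) • ∫ q, Ψ (‖s‖ ^ 2, q.1) •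
      expProdL x b (fun j => paramFreq lam (‖s‖ ^ 2) j q) ∂(paramMeasure ν)) μ := by
  refine Integrable.mono' ((integrable_decay μ).mul_const
    (C * (4 ^ (n + 1) * ∏ j, ‖b j‖) * (paramMeasure ν).real univ)) ?_
    (Eventually.of_forall fun s => ?_)
  · have h1 : Continuous fun s : E => (‖s‖ : ℂ) ^ (2 * p) := by fun_prop
    refine h1.aestronglyMeasurable.smul ?_
    exact ((h.stronglyMeasurable_expProdL x b hΨ).comp_measurable
      (g := fun s : E => ‖s‖ ^ 2) (by fun_prop)).aestronglyMeasurable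
  · rw [← integral_smul, ← mul_assoc]
    refine norm_integral_le_of_norm_le_const (Eventually.of_forall fun q => ?_)
    have h1 := norm_inv_decay_mul_le hC s q.1
    rw [norm_mul, norm_inv, Complex.norm_real, Real.norm_of_nonneg (decay_pos s).le,
      inv_mul_le_iff₀ (decay_pos s)] at h1
    rw [smul_smul, norm_smul, ← mul_assoc]
    exact mul_le_mul h1 (norm_expProdL_le hx b _) (norm_nonneg _) ((norm_nonneg _).trans h1)

end Linfty

end MOI

/-! ### The theorem -/

set_option maxHeartbeats 1000000 in
theorem theorem6p3 (d : ℕ) (hd : 2 ≤ d) (θ : Matrix (Fin d) (Fin d) ℝ) (hθ : θ.transpose = -θ)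
    (x : Linfty θ) (hx : (x : L2 d →L[ℂ] L2 d).IsPositive) (hxu : IsUnit x)
    (f : 𝓢(ℝ, ℂ)) (k n : ℕ) (hk : Even k) (hn : 1 ≤ n) (hkn : k ≤ 2 * n)
    (F : ℝ → ℂ)
    (hF : IsPrimitiveOn (Ioi 0) (fun α => ((α ^ (-(d : ℝ) / 2) : ℝ) : ℂ)) (k / 2) F)
    (b : Fin n → Linfty θ) :
    -- the two symbols define multiple operator integrals
    (∀ s : EuclideanSpace ℝ (Fin d), s ≠ 0 →
      ∃! T, IsMultOpInt (x : L2 d →L[ℂ] L2 d)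
        (divDiff (dilation (‖s‖ ^ (-2 : ℤ)) f) n) T) ∧
    (∃! T, IsMultOpInt (x : L2 d →L[ℂ] L2 d) (divDiff F n) T) ∧
    -- their values lie in `L_∞`, and the integral formula holds
    ∃ (Φ : EuclideanSpace ℝ (Fin d) → Linfty θ) (TF : Linfty θ),
      (∀ s, s ≠ 0 → (Φ s : L2 d →L[ℂ] L2 d) =
        multOpInt (x : L2 d →L[ℂ] L2 d) (divDiff (dilation (‖s‖ ^ (-2 : ℤ)) f) n)
          (fun j => (b j : L2 d →L[ℂ] L2 d))) ∧
      (TF : L2 d →L[ℂ] L2 d) =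
        multOpInt (x : L2 d →L[ℂ] L2 d) (divDiff F n) (fun j => (b j : L2 d →L[ℂ] L2 d)) ∧
      Integrable (fun s : EuclideanSpace ℝ (Fin d) => (‖s‖ ^ (-(k : ℤ)) : ℝ) • Φ s) ∧
      Integrable (fun s : EuclideanSpace ℝ (Fin d) => iteratedDeriv (k / 2) f (‖s‖ ^ 2)) ∧
      ∫ s : EuclideanSpace ℝ (Fin d), (‖s‖ ^ (-(k : ℤ)) : ℝ) • Φ s =
        (∫ s : EuclideanSpace ℝ (Fin d), iteratedDeriv (k / 2) f (‖s‖ ^ 2)) • TF := by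
  obtain ⟨j, rfl⟩ := hk
  -- The condition `k ≤ 2n` makes `p = n - k/2` a natural number: the number of integrations by
  -- parts.
  obtain ⟨p, rfl⟩ : ∃ p, n = p + j := ⟨n - j, by lia⟩
  rw [show (j + j) / 2 = j by lia] at *
  have : Nontrivial (EuclideanSpace ℝ (Fin d)) :=
    Module.nontrivial_of_finrank_pos (R := ℝ) (by rw [finrank_euclideanSpace_fin]; lia)
  have hfr : Module.finrank ℝ (EuclideanSpace ℝ (Fin d)) = d := finrank_euclideanSpace_fin
  have hsa : IsSelfAdjoint (x : L2 d →L[ℂ] L2 d) := hx.isSelfAdjoint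
  have hu : IsUnit (x : L2 d →L[ℂ] L2 d) := hxu.map (Linfty θ).subtype
  obtain ⟨m, M, hm, hmM, hspec⟩ := exists_spectrum_subset_Icc hx hu
  obtain ⟨Ω, _, ν, lam, _, h⟩ := exists_isSimplex (p + j)
  obtain ⟨G, U, hUo, hU, hU0, hFG⟩ :=
    exists_schwartz_eqOn (hF.contDiffOn (contDiffOn_rpow_Ioi _)) hm hmM
  have hG : ∀ u ∈ Icc m M, iterDeriv (p + j) G u =
      (∏ i ∈ Finset.range p, (-(Module.finrank ℝ (EuclideanSpace ℝ (Fin d)) : ℂ) / 2 - i)) *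
        ((u ^ (-(Module.finrank ℝ (EuclideanSpace ℝ (Fin d)) : ℝ) / 2 - p) : ℝ) : ℂ) := by
    intro u hu
    have h1 := hF.iteratedDeriv_add_eq p (hm.trans_le hu.1)
    have h2 : iteratedDeriv (p + j) G u = iteratedDeriv (p + j) F u := by
      refine Filter.EventuallyEq.iteratedDeriv_eq _ ?_
      filter_upwards [hUo.mem_nhds (hU hu)] with v hv using (hFG hv).symm
    rw [coe_iterDeriv, h2, h1, hfr]
    push_cast
    rfl
  have hFdd : ∀ α : Fin (p + j + 1) → ℝ, (∀ i, α i ∈ Icc m M) →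
      divDiff F (p + j) α = ∫ ω, iterDeriv (p + j) G (∑ i, lam i ω * α i) ∂ν := fun α hα => by
    rw [divDiff_congr hUo hFG _ α fun i => hU (hα i), h.divDiff_eq]
  -- the operator integral of `F^{[n]}`
  obtain ⟨Ψ₁, hΨ₁, ⟨C₁, hC₁⟩, hrep₁⟩ := exists_dilation_rep (iterDeriv (p + j) G) hm hmM 0
  have hψm : Measurable fun ζ => Ψ₁ (1, ζ) := hΨ₁.comp (by fun_prop)
  have hψC : ∀ ζ, ‖Ψ₁ (1, ζ)‖ ≤ C₁ := fun ζ => by simpa using hC₁ 1 ζ zero_le_one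
  have hψ : ∀ u ∈ Icc m M, iterDeriv (p + j) G u = ∫ ζ, Ψ₁ (1, ζ) *
      Complex.exp ((freq 1 ζ * u : ℝ) * Complex.I) ∂(cauchyMeasure.prod cauchyMeasure) :=
    fun u hu => by rw [← hrep₁ 1 u one_pos hu, one_mul]
  have hTF := h.isMultOpInt hsa hspec hψm hψC hψ hFdd
  -- the operator integrals of the dilated functions
  obtain ⟨Ψ, hΨ, ⟨C, hC⟩, hrep⟩ := exists_dilation_rep (iterDeriv p (iterDeriv j f)) hm hmM
    (p + (Module.finrank ℝ (EuclideanSpace ℝ (Fin d)) + 1))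
  have hΨm : ∀ c, Measurable fun ζ => Ψ (c, ζ) := fun c => hΨ.comp (by fun_prop)
  have hΨC : ∀ c, 0 ≤ c → ∀ ζ, ‖Ψ (c, ζ)‖ ≤ C := fun c hc ζ => by
    refine le_trans ?_ (hC c ζ hc)
    exact le_mul_of_one_le_left (norm_nonneg _) (one_le_pow₀ (by linarith))
  have hTs : ∀ s : EuclideanSpace ℝ (Fin d), s ≠ 0 → IsMultOpInt (x : L2 d →L[ℂ] L2 d)
      (divDiff (dilation (‖s‖ ^ (-2 : ℤ)) f) (p + j)) fun V =>
        ∫ q, (((‖s‖ ^ 2 : ℝ) : ℂ) ^ (p + j) * Ψ (‖s‖ ^ 2, q.1)) •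
          expProd (x : L2 d →L[ℂ] L2 d) V (fun i => paramFreq lam (‖s‖ ^ 2) i q)
          ∂(paramMeasure ν) := by
    intro s hs
    have hc : 0 < ‖s‖ ^ 2 := by positivity
    refine h.isMultOpInt hsa hspec (ψ := fun ζ => ((‖s‖ ^ 2 : ℝ) : ℂ) ^ (p + j) * Ψ (‖s‖ ^ 2, ζ))
      ((hΨm _).const_mul _) (C := (‖s‖ ^ 2) ^ (p + j) * C) (fun ζ => ?_) (c := ‖s‖ ^ 2)
      (g := fun u => ((‖s‖ ^ 2 : ℝ) : ℂ) ^ (p + j) * iterDeriv (p + j) f (‖s‖ ^ 2 * u))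
      (fun u hu => ?_) (fun α hα => ?_)
    · rw [norm_mul, norm_pow, Complex.norm_real, Real.norm_of_nonneg hc.le]
      gcongr
      exact hΨC _ hc.le ζ
    · simp_rw [mul_assoc]
      rw [integral_const_mul, ← hrep _ u hc hu, iterDeriv_iterDeriv]
    · rw [show ‖s‖ ^ (-2 : ℤ) = (‖s‖ ^ 2)⁻¹ by rw [zpow_neg]; rfl, h.divDiff_dilation_eq f hc.ne']
  have e := L2Basis d
  -- the integral formula
  have hint := h.isMultOpInt_integral (μ := volume) hsa hm hspec hΨ (iterDeriv j f) p hC hrep hG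
    (φ := fun α => (∫ s : EuclideanSpace ℝ (Fin d), iterDeriv j f (‖s‖ ^ 2)) *
      divDiff F (p + j) α) (fun α hα => by rw [hFdd α hα])
  -- A second operator integral for the symbol of `hint`, namely that of `F^{[n]}` with the scalar
  -- integral absorbed into the coefficient. Uniqueness equates the two.
  have hTF' := h.isMultOpInt hsa hspec
    (hψm.const_mul (∫ s : EuclideanSpace ℝ (Fin d), iterDeriv j f (‖s‖ ^ 2)))
    (C := ‖∫ s : EuclideanSpace ℝ (Fin d), iterDeriv j f (‖s‖ ^ 2)‖ * C₁)
    (fun ζ => by rw [norm_mul]; exact mul_le_mul_of_nonneg_left (hψC ζ) (norm_nonneg _))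
    (g := fun u => (∫ s : EuclideanSpace ℝ (Fin d), iterDeriv j f (‖s‖ ^ 2)) *
      iterDeriv (p + j) G u)
    (fun u hu => by simp_rw [mul_assoc]; rw [integral_const_mul, ← hψ u hu])
    (φ := fun α => (∫ s : EuclideanSpace ℝ (Fin d), iterDeriv j f (‖s‖ ^ 2)) *
      divDiff F (p + j) α) (fun α hα => by rw [hFdd α hα, integral_const_mul])
  have hformula := congrFun (IsMultOpInt.unique e hsa hint hTF')
    (fun i => (b i : L2 d →L[ℂ] L2 d))
  have hiL : ∀ c, 0 ≤ c → Integrable (fun q => Ψ (c, q.1) •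
      expProdL x b (fun i => paramFreq lam c i q)) (paramMeasure ν) := fun c hc =>
    h.integrable_smul_expProdL hsa b (hΨm c) (hΨC c hc) c
  have hΦint := h.integrable_norm_pow_smul (volume : Measure (EuclideanSpace ℝ (Fin d))) hsa b hΨ hC
  have hΦeq : (fun s : EuclideanSpace ℝ (Fin d) => (‖s‖ ^ (-((j + j : ℕ) : ℤ)) : ℝ) •
      (((‖s‖ ^ 2 : ℝ) : ℂ) ^ (p + j) • ∫ q, Ψ (‖s‖ ^ 2, q.1) •
        expProdL x b (fun i => paramFreq lam (‖s‖ ^ 2) i q) ∂(paramMeasure ν))) =ᵐ[volume]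
      fun s => ((‖s‖ : ℂ) ^ (2 * p)) • ∫ q, Ψ (‖s‖ ^ 2, q.1) •
        expProdL x b (fun i => paramFreq lam (‖s‖ ^ 2) i q) ∂(paramMeasure ν) := norm_zpow_smul_ae_eq volume j p _
  -- The witnesses are Bochner integrals formed inside `L_∞`, so membership is automatic and
  -- integrability holds with values in `L_∞`. The value at `s = 0` plays no role.
  refine ⟨fun s hs => ⟨_, hTs s hs, fun T' hT' => IsMultOpInt.unique e hsa hT' (hTs s hs)⟩,
    ⟨_, hTF, fun T' hT' => IsMultOpInt.unique e hsa hT' hTF⟩,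
    fun s => ((‖s‖ ^ 2 : ℝ) : ℂ) ^ (p + j) • ∫ q, Ψ (‖s‖ ^ 2, q.1) •
      expProdL x b (fun i => paramFreq lam (‖s‖ ^ 2) i q) ∂(paramMeasure ν),
    ∫ q, Ψ₁ (1, q.1) • expProdL x b (fun i => paramFreq lam 1 i q) ∂(paramMeasure ν),
    fun s hs => ?_, ?_, hΦint.congr hΦeq.symm, ?_, ?_⟩
  · rw [(hTs s hs).multOpInt_eq e hsa]
    simp_rw [← smul_smul, integral_smul]
    rw [coe_smul_Linfty, coe_integral_Linfty (hiL _ (by positivity))]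
    rfl
  · rw [hTF.multOpInt_eq e hsa,
      coe_integral_Linfty (h.integrable_smul_expProdL hsa b hψm hψC 1)]
    rfl
  · have h1 := integrable_norm_pow_mul (E := EuclideanSpace ℝ (Fin d)) (μ := volume)
      (iterDeriv j f) one_pos 0
    simpa [coe_iterDeriv] using h1
  · rw [integral_congr_ae hΦeq]
    -- The inclusion of `L_∞` into the bounded operators commutes with Bochner integrals, so
    -- equality may be checked there, where `hformula` applies.
    refine Subtype.ext ?_
    rw [coe_integral_Linfty hΦint, coe_smul_Linfty,
      coe_integral_Linfty (h.integrable_smul_expProdL hsa b hψm hψC 1)]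
    simp_rw [← coe_iterDeriv, coe_smul_Linfty,
      coe_integral_Linfty (hiL _ (sq_nonneg ‖_‖))]
    simp_rw [← smul_smul, integral_smul] at hformula
    exact hformula
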